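/- Conventions. All fields are smooth complex-valued functions on an open neighbourhood $U\subset\mathbb R^3$ of the point $i=0$ (real fields being a special case). Fix $m\in\mathbb R$, $m\neq 0$, and put $\mu=m^2/4$. A solution of the conformal static vacuum field equations on $U$ consists of a non-degenerate symmetric tensor $h_{ab}$ (the metric, with Levi-Civita derivative $D$), functions $\zeta$, $s$, and a symmetric, $h$-trace-free tensor $s_{ab}$ such that on $U$ $$R_{ab}[h]=s_{ab},\qquad D_aD_b\zeta-s\,h_{ab}+\zeta(1-\mu\zeta)\,s_{ab}=0,\qquad D_as+(1-\mu\zeta)\,s_{ab}D^b\zeta=0,$$ $$(1-\mu\zeta)D_{[c}s_{a]b}-\mu\big(2D_{[c}\zeta\,s_{a]b}+D^d\zeta\,s_{d[c}h_{a]b}\big)=0,$$ and $\zeta(i)=0$, $D_a\zeta(i)=0$, $D_aD_b\zeta(i)=-2h_{ab}(i)$. The coordinates $x^a$ are assumed to be normal coordinates centered at $i$ based on a normal frame $c_{\mathbf a}=c^b{}_{\mathbf a}\partial_b$: $h(c_{\mathbf a},c_{\mathbf b})=-\delta_{\mathbf{ab}}$, $c^b{}_{\mathbf a}(0)=\delta^b{}_{\mathbf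 a}$, $\Gamma^a{}_{bc}(x)x^bx^c=0$ (the lines $t\mapsto tx$ are geodesics) and $x^bD_bc_{\mathbf a}=0$ (the frame is parallel along them). A tensor with frame components $T_{\mathbf a_1\ldots\mathbf a_p}$ is written as a space spinor $T_{A_1B_1\ldots A_pB_p}=T_{\mathbf a_1\ldots\mathbf a_p}\alpha^{a_1}{}_{A_1B_1}\cdots\alpha^{a_p}{}_{A_pB_p}$, where $\xi_a\alpha^a{}_{AB}=\frac1{\sqrt2}\begin{pmatrix}-\xi_1+i\xi_2&\xi_3\\ \xi_3&\xi_1+i\xi_2\end{pmatrix}$. The reality condition for a space spinor with $p$ index pairs is $T_{A_1B_1\ldots A_pB_p}=(-1)^p\,T^+_{A_1B_1\ldots A_pB_p}$, where $\xi^+_{A\ldots H}=\tau_A{}^{A'}\cdots\tau_H{}^{H'}\bar\xi_{A'\ldots H'}$, $\tau_0{}^{1'}=-1$, $\tau_1{}^{0'}=1$, $\tau_0{}^{0'}=\tau_1{}^{1'}=0$. The coefficients of the normal expansion at $i$ of a tensor field $T$ are the space spinors $D_{A_pB_p}\cdots D_{A_1B_1}T_{C_1D_1\ldots C_nD_n}(i)$,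 $p\ge0$. Lemma. Let $\psi_{A_pB_p\ldots A_1B_1}$, $p\ge2$, be a sequence of totally symmetric spinors satisfying the reality condition. Let $h,\zeta,s,s_{ab}$ be a solution as above whose null data in the normal frame are these spinors, i.e. $$\psi_{A_pB_p\ldots A_1B_1}=D_{(A_pB_p}\cdots D_{A_3B_3}\,s_{A_2B_2A_1B_1)}(i),\qquad p\ge2 .$$ Then: 1. (Reality) The coefficients of the normal expansions of $h$, $\zeta$, $s$ and $s_{ABCD}$ at $i$ satisfy the reality conditions, and all partial derivatives at $0$ of the metric coefficients $h_{ab}$ and of the frame coefficients $c^b{}_{\mathbf a}$ in the normal coordinates are real. 2. (Uniqueness) These coefficients and partial derivatives are uniquely determined by $m$ and the data: any other such solution (on a possibly different neighbourhood of $i=0$, in normal coordinates and with a normal frame as above), with the same $m$ and the same null data, has the same coefficients $D_{A_pB_p}\cdots D_{A_1B_1}T(i)$ for $T=h,\zeta,s,s_{ABCD}$ and all $p\ge0$, and the same partial derivatives of all orders at $0$ of $h_{ab}$ and $c^b{}_{\mathbf a}$. -/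

import Mathlib

namespace StaticNull

open scoped ContDiff Matrix

/-! ### Tensor calculus in coordinates

The fields are functions of three real coordinates.  They are allowed to be complex valued, so that
the reality of their expansion coefficients is a statement with content; real fields are the special
case in which all components happen to be real. -/

/-- Points of the real coordinate space. -/
abbrev Coord : Type := Fin 3 → ℝ

/-- The `p`-fold covariant (complex) tensors over a 3-dimensional space, given by components. -/
abbrev Tens (p : ℕ) : Type := (Fin p → Fin 3) → ℂ

/-- A field of `3 × 3` matrices. -/
abbrev MatField : Type := Coord → Matrix (Fin 3) (Fin 3) ℂ

/-- The partial derivative `∂_a f`. -/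
noncomputable def pd (a : Fin 3) (f : Coord → ℂ) (x : Coord) : ℂ :=
  fderiv ℝ f x (Pi.single a 1)

/-- The Christoffel symbols `Γ^a_{bc}` of the metric `h`. -/
noncomputable def christoffel (h : MatField) (a b c : Fin 3) (x : Coord) : ℂ :=
  (1 / 2) * ∑ d, (h x)⁻¹ a d *
    (pd b (fun y => h y d c) x + pd c (fun y => h y d b) x - pd d (fun y => h y b c) x)

/-- The Ricci tensor
`R_{ab} = ∂_c Γ^c_{ab} - ∂_b Γ^c_{ac} + Γ^c_{cd} Γ^d_{ab} - Γ^c_{bd} Γ^d_{ac}`. -/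
noncomputable def ricci (h : MatField) (a b : Fin 3) (x : Coord) : ℂ :=
  ∑ c, (pd c (christoffel h c a b) x - pd b (christoffel h c a c) x
    + ∑ d, (christoffel h c c d x * christoffel h d a b x
      - christoffel h c b d x * christoffel h d a c x))

/-- The covariant derivative `D_c T_{a_1 … a_n}` of a covariant tensor field; the new index `c` is
the first one. -/
noncomputable def covD {n : ℕ} (h : MatField) (T : Coord → Tens n) : Coord → Tens (n + 1) :=
  fun x i => pd (i 0) (fun y => T y (Fin.tail i)) x
    - ∑ j : Fin n, ∑ d : Fin 3,
        christoffel h d (i 0) (i j.succ) x * T x (Function.update (Fin.tail i) j d)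

/-- `D_{c_p} ⋯ D_{c_1} T_{a_1 … a_n}`, with indices in the order `c_p, …, c_1, a_1, …, a_n`. -/
noncomputable def iterCovD {n : ℕ} (h : MatField) (T : Coord → Tens n) :
    (p : ℕ) → Coord → Tens (n + p)
  | 0 => T
  | p + 1 => covD h (iterCovD h T p)

/-- A scalar field as a tensor field without indices. -/
def scalarT (f : Coord → ℂ) : Coord → Tens 0 := fun x _ => f x

/-- A matrix field `M_{ab}` as a tensor field with two indices. -/
def matT (M : MatField) : Coord → Tens 2 := fun x i => M x (i 0) (i 1)

/-- Components of the tensor `T_{a_1 … a_n}` in the frame `c_{𝐚} = c^b_{𝐚} ∂_b`, where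
`c b a` stands for `c^b_{𝐚}`. -/
noncomputable def frameComp {n : ℕ} (c : Matrix (Fin 3) (Fin 3) ℂ) (T : Tens n) : Tens n :=
  fun a => ∑ b : Fin n → Fin 3, (∏ j, c (b j) (a j)) * T b

/-! ### The conformal static vacuum field equations -/

/-- The conformal static vacuum field equations on `U` for the metric `h`, the functions
`ζ` and `s`, and the trace free symmetric tensor `σ` (that is, `s_{ab}`), with ADM mass `m` and
`μ = m² / 4`.  The distinguished point `i` is the coordinate origin. -/
structure IsConformalStaticVacuum (m : ℝ) (U : Set Coord) (h : MatField) (ζ s : Coord → ℂ)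
    (σ : MatField) : Prop where
  smooth_h : ∀ a b, ContDiffOn ℝ ∞ (fun x => h x a b) U
  smooth_zeta : ContDiffOn ℝ ∞ ζ U
  smooth_s : ContDiffOn ℝ ∞ s U
  smooth_sigma : ∀ a b, ContDiffOn ℝ ∞ (fun x => σ x a b) U
  h_symm : ∀ x ∈ U, ∀ a b, h x a b = h x b a
  h_nondeg : ∀ x ∈ U, (h x).det ≠ 0
  sigma_symm : ∀ x ∈ U, ∀ a b, σ x a b = σ x b a
  /-- `h^{ab} s_{ab} = 0` -/
  sigma_trace : ∀ x ∈ U, ∑ a, ∑ b, (h x)⁻¹ a b * σ x a b = 0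
  /-- `ζ = 0` at `i` -/
  zeta_zero : ζ 0 = 0
  /-- `D_a ζ = 0` at `i` -/
  dzeta_zero : ∀ a, pd a ζ 0 = 0
  /-- `D_a D_b ζ = -2 h_{ab}` at `i` -/
  ddzeta_zero : ∀ a b, covD h (covD h (scalarT ζ)) 0 ![a, b] = -2 * h 0 a b
  /-- `R_{ab}[h] = s_{ab}` -/
  ricci_eq : ∀ x ∈ U, ∀ a b, ricci h a b x = σ x a b
  /-- `D_a D_b ζ - s h_{ab} + ζ (1 - μ ζ) s_{ab} = 0` -/
  hess_eq : ∀ x ∈ U, ∀ a b, covD h (covD h (scalarT ζ)) x ![a, b] - s x * h x a b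
    + ζ x * (1 - (m : ℂ) ^ 2 / 4 * ζ x) * σ x a b = 0
  /-- `D_a s + (1 - μ ζ) s_{ab} D^b ζ = 0` -/
  ds_eq : ∀ x ∈ U, ∀ a, pd a s x
    + (1 - (m : ℂ) ^ 2 / 4 * ζ x) * ∑ b, σ x a b * ∑ d, (h x)⁻¹ b d * pd d ζ x = 0
  /-- `(1 - μ ζ) D_{[c} s_{a]b} - μ (2 D_{[c} ζ s_{a]b} + D^d ζ s_{d[c} h_{a]b}) = 0` -/
  cotton_eq : ∀ x ∈ U, ∀ c a b,
    (1 - (m : ℂ) ^ 2 / 4 * ζ x)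
        * ((covD h (matT σ) x ![c, a, b] - covD h (matT σ) x ![a, c, b]) / 2)
      - (m : ℂ) ^ 2 / 4 * ((pd c ζ x * σ x a b - pd a ζ x * σ x c b)
        + ∑ d, (∑ e, (h x)⁻¹ d e * pd e ζ x) * ((σ x d c * h x a b - σ x d a * h x c b) / 2)) = 0

/-- The coordinates are normal coordinates for `h` centered at `i`, and `c` (with `c x b a` the
coefficient `c^b_{𝐚}` at `x`) is the `h`-orthonormal normal frame centered at `i` on which they are
based: `h(c_{𝐚}, c_{𝐛}) = -δ_{𝐚𝐛}`, `c^b_{𝐚} = δ^b_{𝐚}` at `i`, the lines `t ↦ t x` are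
affinely parametrized `h`-geodesics, and the `c_{𝐚}` are parallel along them. -/
structure IsNormalFrame (U : Set Coord) (h c : MatField) : Prop where
  smooth : ∀ a b, ContDiffOn ℝ ∞ (fun x => c x a b) U
  orthonormal : ∀ x ∈ U, (c x)ᵀ * h x * c x = -1
  at_zero : c 0 = 1
  geodesic : ∀ x ∈ U, ∀ a, ∑ b, ∑ d, christoffel h a b d x * (x b : ℂ) * (x d : ℂ) = 0
  parallel : ∀ x ∈ U, ∀ d a, ∑ b, (x b : ℂ) *
    (pd b (fun y => c y d a) x + ∑ e, christoffel h d b e x * c x e a) = 0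

/-! ### Space spinors -/

/-- Space spinors `T_{A_1 B_1 … A_p B_p}`; the positions `(j, 0)` and `(j, 1)` carry the indices
of the `j`-th pair. -/
abbrev Spinor (p : ℕ) : Type := (Fin p × Fin 2 → Fin 2) → ℂ

/-- The van der Waerden symbols `α^a_{AB}`. -/
noncomputable def vdW : Fin 3 → Matrix (Fin 2) (Fin 2) ℂ :=
  ![((1 / Real.sqrt 2 : ℝ) : ℂ) • !![-1, 0; 0, 1],
    ((1 / Real.sqrt 2 : ℝ) : ℂ) • !![Complex.I, 0; 0, Complex.I],
    ((1 / Real.sqrt 2 : ℝ) : ℂ) • !![0, 1; 1, 0]]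

/-- The space spinor
`T_{A_1 B_1 … A_p B_p} = T_{a_1 … a_p} α^{a_1}_{A_1 B_1} ⋯ α^{a_p}_{A_p B_p}`
of a tensor given in the frame. -/
noncomputable def toSpinor {p : ℕ} (T : Tens p) : Spinor p :=
  fun A => ∑ a : Fin p → Fin 3, T a * ∏ j, vdW (a j) (A (j, 0)) (A (j, 1))

/-- The matrix `τ_A^{A'}`, obtained from `τ^{AA'} = δ^{AA'}` by `τ_A^{A'} = τ^{BA'} ε_{BA}`,
`ε_{01} = 1`. -/
def tau : Matrix (Fin 2) (Fin 2) ℂ := !![0, -1; 1, 0]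

/-- `ξ^+_{A … H} = τ_A^{A'} ⋯ τ_H^{H'} \bar ξ_{A' … H'}`. -/
noncomputable def plus {p : ℕ} (ξ : Spinor p) : Spinor p :=
  fun A => ∑ A' : Fin p × Fin 2 → Fin 2, (∏ k, tau (A k) (A' k)) * starRingEnd ℂ (ξ A')

/-- The reality condition `T = (-1)^p T^+` for space spinors with `p` index pairs. -/
def IsRealSpinor {p : ℕ} (ξ : Spinor p) : Prop :=
  ∀ A, ξ A = (-1) ^ p * plus ξ A

/-- Symmetry in all `2 p` spinor indices. -/
def IsTotallySymmetric {p : ℕ} (ξ : Spinor p) : Prop :=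
  ∀ (π : Equiv.Perm (Fin p × Fin 2)) (A : Fin p × Fin 2 → Fin 2), ξ (A ∘ π) = ξ A

/-- Symmetrization `T_{(A_1 B_1 … A_p B_p)}` over all `2 p` spinor indices. -/
noncomputable def symmetrize {p : ℕ} (ξ : Spinor p) : Spinor p :=
  fun A => ((2 * p).factorial : ℂ)⁻¹ * ∑ π : Equiv.Perm (Fin p × Fin 2), ξ (A ∘ π)

/-- The coefficient `D_{A_p B_p} ⋯ D_{A_1 B_1} T_{…}(i)` of order `p` in the normal expansion of
the tensor field `T`, as a space spinor in the frame `c`. -/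
noncomputable def normalCoeff {n : ℕ} (h c : MatField) (T : Coord → Tens n) (p : ℕ) :
    Spinor (n + p) :=
  toSpinor (frameComp (c 0) (iterCovD h T p 0))

/-- The null datum `D_{(A_p B_p} ⋯ D_{A_3 B_3} s_{A_2 B_2 A_1 B_1)}(i)`, `p = 2 + q`, of the
trace free tensor `σ` in the frame `c`. -/
noncomputable def nullDatum (h c σ : MatField) (q : ℕ) : Spinor (2 + q) :=
  symmetrize (normalCoeff h c (matT σ) q)

end StaticNull

/-!
Write `I_k` for the ideal of power series without terms of degree less than `k`, and `δ` for the
difference of the Taylor series at `i` of two solutions with the same null data.  Uniqueness says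
that `δ` vanishes, and it is proved by showing that for every `k`
`δh ∈ I_{k+1}`, `δs_{ab} ∈ I_k`, `δζ ∈ I_{k+2}` and `δs ∈ I_{k+1}`
(`sub_mem_vanish_of_nullDatumS_eq`).  In the step from `k` to `k + 1` only the linearization of the
equations at the flat metric matters.

* Metric (`metric_sub_mem_vanish`): in normal coordinates `δh_{ab} x^b = 0` by the Gauss lemma.
  The linearized Ricci tensor of `δh` lies in `I_k` because `R_{ab} = s_{ab}`, and in dimension
  three it determines the linearized Riemann tensor.  The radial components of the latter are
  `-(E² + E) δh_{ab}`, where `E = x^a ∂_a` multiplies terms of degree `n` by `n`.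
* Functions (`s_sub_mem_vanish`, `zeta_sub_mem_vanish`): the equations express `D_a s` and
  `D_a D_b ζ` by quantities which are already known to sufficient order.
* Tensor `s_{ab}` (`sigma_sub_mem_vanish`): by the equation for `D_{[c} s_{a]b}` the terms of degree
  `k` of `δs_{ab}` are curl free, so that they are the Hessian of a function `φ`, which is
  harmonic since `s_{ab}` is trace free.  The derivatives of `φ` of order `k + 2` form a totally
  symmetric trace free tensor, whose spinor is totally symmetric (`isTotallySymmetric_toSpinor`).
  It is therefore equal to its symmetrization, which is the difference of two equal null data.

The frame is determined by the metric, being parallel along the radial lines.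

Reality follows from uniqueness: the complex conjugate fields solve the same equations in a normal
frame (`IsConformalStaticVacuum.conj`, `IsNormalFrame.conj`), and by the reality condition on `ψ`
they have the same null data (`nullDatum_conj`).
-/

namespace StaticNull

open MvPowerSeries Filter Topology
open scoped ContDiff Matrix

/-! ### Formal power series and their order of vanishing -/

/-- Formal power series in the three coordinates; they hold the Taylor series at the point `i`. -/
abbrev Series : Type := MvPowerSeries (Fin 3) ℂ

/-- The formal partial derivative `∂_a`. -/
noncomputable abbrev dS (a : Fin 3) : Derivation ℂ Series Series := MvPowerSeries.pderiv ℂ a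

/-- The ideal of the power series all of whose terms have degree at least `k`. -/
noncomputable def vanish (k : ℕ) : Ideal Series where
  carrier := {f | (k : ℕ∞) ≤ f.order}
  zero_mem' := by simp
  add_mem' hf hg := (le_min hf hg).trans min_order_le_add
  smul_mem' c f hf := by
    simp only [Set.mem_ofPred_eq] at hf ⊢
    exact (hf.trans le_add_self).trans le_order_mul

theorem mem_vanish {k : ℕ} {f : Series} :
    f ∈ vanish k ↔ ∀ n : Fin 3 →₀ ℕ, n.degree < k → coeff n f = 0 := by
  constructor
  · intro hf n hn
    refine coeff_of_lt_order (lt_of_lt_of_le ?_ hf)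
    exact_mod_cast hn
  · intro hf
    exact nat_le_order hf

theorem mem_vanish_zero (f : Series) : f ∈ vanish 0 := by
  simp [mem_vanish]

theorem vanish_anti {j k : ℕ} (h : j ≤ k) : vanish k ≤ vanish j := fun _ hf =>
  mem_vanish.2 fun n hn => mem_vanish.1 hf n (hn.trans_le h)

theorem vanish_of_le {j k : ℕ} (h : j ≤ k) {f : Series} (hf : f ∈ vanish k) : f ∈ vanish j :=
  vanish_anti h hf

theorem mul_mem_vanish {j k l : ℕ} {f g : Series} (hf : f ∈ vanish j) (hg : g ∈ vanish k)
    (h : l ≤ j + k) : f * g ∈ vanish l := by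
  refine vanish_of_le h ?_
  refine le_trans ?_ (le_order_mul (f := f) (g := g))
  rw [Nat.cast_add]
  exact add_le_add hf hg

theorem C_mul_mem_vanish_iff {k : ℕ} {z : ℂ} (hz : z ≠ 0) {f : Series} :
    (C z : Series) * f ∈ vanish k ↔ f ∈ vanish k := by
  simp only [mem_vanish, coeff_C_mul, mul_eq_zero, hz, false_or]

theorem mem_vanish_one {f : Series} : f ∈ vanish 1 ↔ constantCoeff f = 0 := by
  rw [mem_vanish]
  constructor
  · intro h
    exact h 0 (by simp)
  · intro h n hn
    have : n = 0 := by
      rw [← Finsupp.degree_eq_zero_iff]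
      omega
    rw [this]
    exact h

theorem X_mem_vanish (a : Fin 3) : (X a : Series) ∈ vanish 1 := by
  simp [mem_vanish_one]

theorem eq_zero_of_forall_mem_vanish {f : Series} (h : ∀ k, f ∈ vanish k) : f = 0 := by
  ext n
  exact mem_vanish.1 (h (n.degree + 1)) n (Nat.lt_succ_self _)

theorem dS_mem_vanish {k l : ℕ} {f : Series} (hf : f ∈ vanish k) (a : Fin 3) (h : l + 1 ≤ k) :
    dS a f ∈ vanish l := by
  rw [mem_vanish] at hf ⊢
  intro n hn
  rw [coeff_pderiv, hf, zero_mul]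
  rw [map_add, Finsupp.degree_single]
  omega

theorem exists_eq_add_single {n : Fin 3 →₀ ℕ} (hn : n ≠ 0) :
    ∃ a m, n = m + Finsupp.single a 1 := by
  obtain ⟨a, ha⟩ := Finsupp.ne_iff.1 hn
  refine ⟨a, n - Finsupp.single a 1, ?_⟩
  rw [tsub_add_cancel_of_le]
  rw [Finsupp.single_le_iff]
  exact Nat.one_le_iff_ne_zero.2 ha

/-- A function vanishes to order `k + 1` if it vanishes at the origin and its partial derivatives
vanish to order `k`. -/
theorem mem_vanish_succ {k : ℕ} {f : Series} (h0 : constantCoeff f = 0)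
    (h : ∀ a, dS a f ∈ vanish k) : f ∈ vanish (k + 1) := by
  rw [mem_vanish]
  intro n hn
  by_cases hz : n = 0
  · rw [hz]
    exact h0
  · obtain ⟨a, m, rfl⟩ := exists_eq_add_single hz
    rw [map_add, Finsupp.degree_single] at hn
    have := mem_vanish.1 (h a) m (by omega)
    rw [coeff_pderiv] at this
    refine (mul_eq_zero.1 this).resolve_right ?_
    exact Nat.cast_add_one_ne_zero (m a)

theorem dS_comm (a b : Fin 3) (f : Series) : dS a (dS b f) = dS b (dS a f) := by
  ext n
  simp only [coeff_pderiv, Finsupp.add_apply]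
  rw [add_right_comm n]
  by_cases h : a = b
  · rw [h]
  · rw [Finsupp.single_eq_of_ne (Ne.symm h), Finsupp.single_eq_of_ne h]
    simp only [add_zero]
    ring

theorem dS_mul (a : Fin 3) (f g : Series) : dS a (f * g) = dS a f * g + f * dS a g := by
  rw [Derivation.leibniz]
  simp only [smul_eq_mul]
  ring

theorem dS_C (a : Fin 3) (z : ℂ) : dS a (C z) = 0 := pderiv_C

theorem dS_X (a b : Fin 3) : dS a (X b) = if a = b then 1 else 0 := by
  split_ifs with h
  · rw [h]
    exact pderiv_X_self
  · exact pderiv_X_of_ne (Ne.symm h)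

/-- The Euler operator `x^a ∂_a`. -/
noncomputable def euler (f : Series) : Series := ∑ a, X a * dS a f

theorem coeff_euler (n : Fin 3 →₀ ℕ) (f : Series) :
    coeff n (euler f) = (n.degree : ℂ) * coeff n f := by
  have key : ∀ a : Fin 3, coeff n (X a * dS a f) = (n a : ℂ) * coeff n f := by
    intro a
    rw [X, coeff_monomial_mul]
    split_ifs with h
    · have h1 : n - Finsupp.single a 1 + Finsupp.single a 1 = n := tsub_add_cancel_of_le h
      have h2 : n a = (n - Finsupp.single a 1 : Fin 3 →₀ ℕ) a + 1 := by
        conv_lhs => rw [← h1]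
        rw [Finsupp.add_apply, Finsupp.single_eq_same]
      rw [coeff_pderiv, h1, h2]
      push_cast
      ring
    · have : n a = 0 := by
        by_contra hne
        exact h (Finsupp.single_le_iff.2 (Nat.one_le_iff_ne_zero.2 hne))
      simp [this]
  rw [euler, map_sum, Finset.sum_congr rfl fun a _ => key a, ← Finset.sum_mul,
    Finsupp.degree_eq_sum]
  push_cast
  rfl

theorem euler_sub (f g : Series) : euler (f - g) = euler f - euler g := by
  simp only [euler, map_sub, mul_sub, Finset.sum_sub_distrib]

/-- `x^a ∂_a` acts on homogeneous terms of degree `k` as multiplication by `k`. -/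
theorem euler_sub_mem_vanish {k : ℕ} {f : Series} (hf : f ∈ vanish k) :
    euler f - C (k : ℂ) * f ∈ vanish (k + 1) := by
  rw [mem_vanish] at hf ⊢
  intro n hn
  rw [map_sub, coeff_euler, coeff_C_mul, ← sub_mul]
  rcases Nat.lt_succ_iff_lt_or_eq.1 hn with h | h
  · rw [hf n h, mul_zero]
  · rw [h, sub_self, zero_mul]

theorem mem_vanish_of_euler_mem {k : ℕ} {f : Series} (h0 : constantCoeff f = 0)
    (hf : euler f ∈ vanish k) : f ∈ vanish k := by
  rw [mem_vanish] at hf ⊢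
  intro n hn
  by_cases hz : n = 0
  · rw [hz]
    exact h0
  · have := hf n hn
    rw [coeff_euler] at this
    refine (mul_eq_zero.1 this).resolve_left ?_
    exact_mod_cast fun h => hz ((Finsupp.degree_eq_zero_iff n).1 h)

/-- On terms of degree `n > 0` the operator `E² + E` is multiplication by `n² + n ≠ 0`. -/
theorem mem_vanish_of_euler_euler_add_mem {k : ℕ} {f : Series} (h0 : constantCoeff f = 0)
    (hf : euler (euler f) + euler f ∈ vanish k) : f ∈ vanish k := by
  rw [mem_vanish] at hf ⊢
  intro n hn
  by_cases hz : n = 0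
  · rw [hz]
    exact h0
  · have := hf n hn
    rw [map_add, coeff_euler, coeff_euler, ← mul_assoc, ← add_mul] at this
    refine (mul_eq_zero.1 this).resolve_left ?_
    have hd : n.degree ≠ 0 := fun h => hz ((Finsupp.degree_eq_zero_iff n).1 h)
    exact_mod_cast (by positivity : n.degree * n.degree + n.degree ≠ 0)

theorem eq_zero_of_euler_eq_zero {f : Series} (h0 : constantCoeff f = 0) (hf : euler f = 0) :
    f = 0 :=
  eq_zero_of_forall_mem_vanish fun k => mem_vanish_of_euler_mem h0 (by rw [hf]; exact zero_mem _)

/-- A solution of `E f = 2 f` is homogeneous of degree two. -/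
theorem eq_zero_of_euler_eq_two_mul {f : Series} (h3 : f ∈ vanish 3) (hf : euler f = 2 * f) :
    f = 0 := by
  ext n
  by_cases hn : n.degree < 3
  · exact mem_vanish.1 h3 n hn
  · have := congrArg (coeff n) hf
    rw [coeff_euler, two_mul, map_add, ← two_mul, ← sub_eq_zero, ← sub_mul] at this
    refine (mul_eq_zero.1 this).resolve_left ?_
    refine sub_ne_zero.2 ?_
    exact_mod_cast (by omega : n.degree ≠ 2)

/-! ### Tensor calculus with formal power series -/

/-- Matrices of power series. -/
abbrev MatS : Type := Matrix (Fin 3) (Fin 3) Series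

/-- The `n`-fold covariant tensors with power series as components. -/
abbrev TensS (n : ℕ) : Type := (Fin n → Fin 3) → Series

/-- The formal Christoffel symbols of the metric `H` with inverse `G`. -/
noncomputable def chrS (H G : MatS) (a b c : Fin 3) : Series :=
  C (1 / 2) * ∑ d, G a d * (dS b (H d c) + dS c (H d b) - dS d (H b c))

/-- The formal Ricci tensor of a connection with Christoffel symbols `Γ`. -/
noncomputable def ricciS (Γ : Fin 3 → Fin 3 → Fin 3 → Series) (a b : Fin 3) : Series :=
  ∑ c, (dS c (Γ c a b) - dS b (Γ c a c) + ∑ d, (Γ c c d * Γ d a b - Γ c b d * Γ d a c))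

/-- The formal covariant derivative; the new index is the first one. -/
noncomputable def covS {n : ℕ} (Γ : Fin 3 → Fin 3 → Fin 3 → Series) (T : TensS n) :
    TensS (n + 1) :=
  fun i => dS (i 0) (T (Fin.tail i))
    - ∑ j : Fin n, ∑ d : Fin 3, Γ d (i 0) (i j.succ) * T (Function.update (Fin.tail i) j d)

/-- The iterated formal covariant derivative. -/
noncomputable def iterCovS {n : ℕ} (Γ : Fin 3 → Fin 3 → Fin 3 → Series) (T : TensS n) :
    (p : ℕ) → TensS (n + p)
  | 0 => T
  | p + 1 => covS Γ (iterCovS Γ T p)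

/-- The iterated partial derivative, with the same order of indices as `iterCovS`. -/
noncomputable def iterDS {n : ℕ} (T : TensS n) : (p : ℕ) → TensS (n + p)
  | 0 => T
  | p + 1 => fun i => dS (i 0) (iterDS T p (Fin.tail i))

/-- A power series as a tensor without indices. -/
def scalarS (f : Series) : TensS 0 := fun _ => f

/-- A matrix of power series as a tensor with two indices. -/
def matTS (M : MatS) : TensS 2 := fun i => M (i 0) (i 1)

theorem covS_covS_scalarS (Γ : Fin 3 → Fin 3 → Fin 3 → Series) (Z : Series) (a b : Fin 3) :
    covS Γ (covS Γ (scalarS Z)) ![a, b] = dS a (dS b Z) - ∑ d, Γ d a b * dS d Z := by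
  simp [covS, scalarS, Fin.tail]

theorem covS_matTS (Γ : Fin 3 → Fin 3 → Fin 3 → Series) (M : MatS) (c a b : Fin 3) :
    covS Γ (matTS M) ![c, a, b]
      = dS c (M a b) - ∑ d, Γ d c a * M d b - ∑ d, Γ d c b * M a d := by
  simp [covS, matTS, Fin.tail, Fin.sum_univ_two, sub_sub]

theorem C_half_mul_two : (C (1 / 2) : Series) * 2 = 1 := by
  have : (2 : Series) = C 2 := (map_ofNat C 2).symm
  rw [this, ← map_mul]
  norm_num

theorem two_ne_zero_series : (2 : Series) ≠ 0 := fun h => by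
  have := C_half_mul_two
  rw [h, mul_zero] at this
  exact zero_ne_one this

/-- The conditions which the field equations and the normal gauge impose on the Taylor series at
`i` of the metric `H`, its inverse `G`, the functions `ζ`, `s`, the tensor `s_{ab}`
(denoted `Q`) and the frame `K`.  The value of `s` at `i` is the one which follows from
`D_a D_b ζ = -2 h_{ab}` there. -/
structure IsFormalSolution (μ : ℂ) (H G : MatS) (Z S : Series) (Q K : MatS) : Prop where
  H_symm : ∀ a b, H a b = H b a
  G_mul : G * H = 1
  H_zero : ∀ a b, constantCoeff (H a b) = if a = b then -1 else 0
  Q_symm : ∀ a b, Q a b = Q b a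
  Q_trace : ∑ a, ∑ b, G a b * Q a b = 0
  Z_zero : constantCoeff Z = 0
  dZ_zero : ∀ a, constantCoeff (dS a Z) = 0
  S_zero : constantCoeff S = -2
  ricci_eq : ∀ a b, ricciS (chrS H G) a b = Q a b
  hess_eq : ∀ a b, covS (chrS H G) (covS (chrS H G) (scalarS Z)) ![a, b] - S * H a b
    + Z * (1 - C μ * Z) * Q a b = 0
  ds_eq : ∀ a, dS a S + (1 - C μ * Z) * ∑ b, Q a b * ∑ d, G b d * dS d Z = 0
  cotton_eq : ∀ c a b,
    (1 - C μ * Z) * (C (1 / 2) * (covS (chrS H G) (matTS Q) ![c, a, b]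
        - covS (chrS H G) (matTS Q) ![a, c, b]))
      - C μ * ((dS c Z * Q a b - dS a Z * Q c b)
        + ∑ d, (∑ e, G d e * dS e Z) * (C (1 / 2) * (Q d c * H a b - Q d a * H c b))) = 0
  geodesic : ∀ a, ∑ b, ∑ d, chrS H G a b d * X b * X d = 0
  K_zero : ∀ a b, constantCoeff (K a b) = if a = b then 1 else 0
  parallel : ∀ d a, ∑ b, X b * (dS b (K d a) + ∑ e, chrS H G d b e * K e a) = 0

/-! ### Differences of products and sums -/

/-- Leibniz rule for differences: each factor of `δf g' + f δg` contributes its own order. -/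
theorem sub_mul_mem_vanish {f f' g g' : Series} {j p q k l : ℕ} (hf : f' - f ∈ vanish j)
    (hg' : g' ∈ vanish p) (hf0 : f ∈ vanish q) (hg : g' - g ∈ vanish k) (h1 : l ≤ j + p)
    (h2 : l ≤ q + k) : f' * g' - f * g ∈ vanish l := by
  have : f' * g' - f * g = (f' - f) * g' + f * (g' - g) := by ring
  rw [this]
  exact add_mem (mul_mem_vanish hf hg' h1) (mul_mem_vanish hf0 hg h2)

/-- Two products agree to the order to which the factors agree. -/
theorem sub_mul_mem_vanish_of_eq {f f' g g' : Series} {l : ℕ} (hf : f' - f ∈ vanish l)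
    (hg : g' - g ∈ vanish l) : f' * g' - f * g ∈ vanish l :=
  sub_mul_mem_vanish hf (mem_vanish_zero _) (mem_vanish_zero _) hg le_rfl (by omega)

theorem sub_sum_mem_vanish {ι : Type*} {s : Finset ι} {F F' : ι → Series} {l : ℕ}
    (h : ∀ i, F' i - F i ∈ vanish l) : ∑ i ∈ s, F' i - ∑ i ∈ s, F i ∈ vanish l := by
  rw [← Finset.sum_sub_distrib]
  exact sum_mem fun i _ => h i

theorem sub_add_mem_vanish {f f' g g' : Series} {l : ℕ} (hf : f' - f ∈ vanish l)
    (hg : g' - g ∈ vanish l) : f' + g' - (f + g) ∈ vanish l := by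
  have : f' + g' - (f + g) = (f' - f) + (g' - g) := by ring
  rw [this]
  exact add_mem hf hg

theorem sub_sub_mem_vanish {f f' g g' : Series} {l : ℕ} (hf : f' - f ∈ vanish l)
    (hg : g' - g ∈ vanish l) : f' - g' - (f - g) ∈ vanish l := by
  have : f' - g' - (f - g) = (f' - f) - (g' - g) := by ring
  rw [this]
  exact sub_mem hf hg

theorem sub_self_mem_vanish (f : Series) (l : ℕ) : f - f ∈ vanish l := by
  rw [sub_self]
  exact zero_mem _

theorem dS_sub_mem_vanish {f f' : Series} {k l : ℕ} (hf : f' - f ∈ vanish k) (a : Fin 3)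
    (h : l + 1 ≤ k) : dS a f' - dS a f ∈ vanish l := by
  rw [← map_sub]
  exact dS_mem_vanish hf a h

/-! ### Dependence of the connection and the curvature on the metric -/

theorem inverse_sub_mem_vanish {H G H' G' : MatS} (hG : G * H = 1) (hG' : G' * H' = 1) {l : ℕ}
    (h : ∀ a b, H' a b - H a b ∈ vanish l) (a b : Fin 3) : G' a b - G a b ∈ vanish l := by
  have hG2 : H * G = 1 := mul_eq_one_comm.1 hG
  have e : G' - G = G' * (-(H' - H)) * G := by
    rw [neg_sub, mul_sub, sub_mul, hG', one_mul, mul_assoc, hG2, mul_one]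
  have e2 := congrFun (congrFun e a) b
  rw [Matrix.sub_apply] at e2
  rw [e2, Matrix.mul_apply]
  refine sum_mem fun c _ => Ideal.mul_mem_right _ _ ?_
  rw [Matrix.mul_apply]
  refine sum_mem fun d _ => Ideal.mul_mem_left _ _ ?_
  rw [Matrix.neg_apply]
  exact neg_mem (h d c)

theorem chrS_sub_mem_vanish {H G H' G' : MatS} (hG : G * H = 1) (hG' : G' * H' = 1) {l : ℕ}
    (h : ∀ a b, H' a b - H a b ∈ vanish (l + 1)) (a b c : Fin 3) :
    chrS H' G' a b c - chrS H G a b c ∈ vanish l := by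
  rw [chrS, chrS, ← mul_sub]
  refine Ideal.mul_mem_left _ _ (sub_sum_mem_vanish fun d => sub_mul_mem_vanish_of_eq ?_ ?_)
  · exact vanish_of_le (Nat.le_succ l) (inverse_sub_mem_vanish hG hG' h a d)
  · exact sub_sub_mem_vanish (sub_add_mem_vanish (dS_sub_mem_vanish (h _ _) _ le_rfl)
      (dS_sub_mem_vanish (h _ _) _ le_rfl)) (dS_sub_mem_vanish (h _ _) _ le_rfl)

/-- The inverse metric is `-δ^{ab}` at the origin. -/
theorem inverse_add_mem_vanish {H G : MatS} (hG : G * H = 1)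
    (h0 : ∀ a b, constantCoeff (H a b) = if a = b then -1 else 0) (a b : Fin 3) :
    G a b + (if a = b then 1 else 0) ∈ vanish 1 := by
  -- compare with the flat metric `-1`, which is its own inverse
  have h1 : (-1 : MatS) * (-1) = 1 := by simp
  have := inverse_sub_mem_vanish (l := 1) h1 hG (fun c d => by
    rw [mem_vanish_one, map_sub, h0]
    by_cases hcd : c = d <;> simp [hcd]) a b
  convert this using 1
  by_cases hab : a = b <;> simp [hab]

/-- The linearization of the Christoffel symbols at the flat metric `-δ_{ab}`. -/
theorem chrS_sub_add_mem_vanish {H G H' G' : MatS} (hG : G * H = 1) (hG' : G' * H' = 1)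
    (h0 : ∀ a b, constantCoeff (H' a b) = if a = b then -1 else 0) {k : ℕ}
    (h : ∀ a b, H' a b - H a b ∈ vanish (k + 1)) (a b c : Fin 3) :
    chrS H' G' a b c - chrS H G a b c + C (1 / 2) * (dS b (H' a c - H a c)
      + dS c (H' a b - H a b) - dS a (H' b c - H b c)) ∈ vanish (k + 1) := by
  have e : chrS H' G' a b c - chrS H G a b c + C (1 / 2) * (dS b (H' a c - H a c)
      + dS c (H' a b - H a b) - dS a (H' b c - H b c))
      = C (1 / 2) * ∑ d, ((G' a d + if a = d then 1 else 0) * (dS b (H' d c - H d c)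
      + dS c (H' d b - H d b) - dS d (H' b c - H b c))
      + (G' a d - G a d) * (dS b (H d c) + dS c (H d b) - dS d (H b c))) := by
    simp only [add_mul, ite_mul, one_mul, zero_mul, Finset.sum_add_distrib, Finset.sum_ite_eq,
      Finset.mem_univ, if_true]
    rw [chrS, chrS, ← mul_sub, ← mul_add, add_right_comm]
    congr 2
    rw [← Finset.sum_sub_distrib, ← Finset.sum_add_distrib]
    refine Finset.sum_congr rfl fun d _ => ?_
    simp only [map_sub]
    ring
  rw [e]
  refine Ideal.mul_mem_left _ _ (sum_mem fun d _ => add_mem ?_ ?_)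
  · refine mul_mem_vanish (inverse_add_mem_vanish hG' h0 a d) (k := k) ?_ (by omega)
    exact sub_mem (add_mem (dS_mem_vanish (h _ _) _ le_rfl) (dS_mem_vanish (h _ _) _ le_rfl))
      (dS_mem_vanish (h _ _) _ le_rfl)
  · exact Ideal.mul_mem_right _ _ (inverse_sub_mem_vanish hG hG' h a d)

/-- The Riemann tensor of the metric perturbation `k` at the flat metric, up to a constant
factor. -/
noncomputable def linRiem (k : MatS) (a b c d : Fin 3) : Series :=
  dS b (dS c (k a d)) + dS a (dS d (k b c)) - dS a (dS c (k b d)) - dS b (dS d (k a c))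

/-- The linearization of the Ricci tensor at the flat metric `-δ_{ab}`. -/
theorem ricciS_sub_add_mem_vanish {H G H' G' : MatS} (hG : G * H = 1) (hG' : G' * H' = 1)
    (hs : ∀ a b, H a b = H b a) (hs' : ∀ a b, H' a b = H' b a)
    (h0 : ∀ a b, constantCoeff (H' a b) = if a = b then -1 else 0) {k : ℕ}
    (h : ∀ a b, H' a b - H a b ∈ vanish (k + 1)) (a b : Fin 3) :
    ricciS (chrS H' G') a b - ricciS (chrS H G) a b
      + C (1 / 2) * ∑ c, linRiem (H' - H) c a c b ∈ vanish k := by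
  have hΓ := chrS_sub_mem_vanish hG hG' h
  have hL := chrS_sub_add_mem_vanish hG hG' h0 h
  have hks : ∀ a b, (H' - H) a b = (H' - H) b a := fun a b => by
    rw [Matrix.sub_apply, Matrix.sub_apply, hs, hs']
  have hka : ∀ a b, H' a b - H a b = (H' - H) a b := fun _ _ => rfl
  simp only [hka] at hL
  rw [ricciS, ricciS, Finset.mul_sum, ← Finset.sum_sub_distrib, ← Finset.sum_add_distrib]
  refine sum_mem fun c _ => ?_
  have h1 := dS_mem_vanish (hL c a b) c (l := k) le_rfl
  have h2 := dS_mem_vanish (hL c a c) b (l := k) le_rfl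
  have h3 : ∑ d, (chrS H' G' c c d * chrS H' G' d a b - chrS H' G' c b d * chrS H' G' d a c)
      - ∑ d, (chrS H G c c d * chrS H G d a b - chrS H G c b d * chrS H G d a c) ∈ vanish k :=
    sub_sum_mem_vanish fun d => sub_sub_mem_vanish
      (sub_mul_mem_vanish_of_eq (hΓ _ _ _) (hΓ _ _ _))
      (sub_mul_mem_vanish_of_eq (hΓ _ _ _) (hΓ _ _ _))
  convert add_mem (sub_mem h1 h2) h3 using 1
  simp only [linRiem, map_add, map_sub, dS_mul, dS_C, zero_mul, zero_add]
  rw [hks a c, dS_comm b c, dS_comm b a, dS_comm a c]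
  ring

/-- In three dimensions an antisymmetric pair of indices takes three values. -/
theorem mem_of_antisymm {I : Ideal Series} {T : Fin 3 → Fin 3 → Series}
    (h : ∀ a b, T a b = -T b a) (h01 : T 0 1 ∈ I) (h02 : T 0 2 ∈ I) (h12 : T 1 2 ∈ I)
    (a b : Fin 3) : T a b ∈ I := by
  have hd : ∀ a, T a a ∈ I := fun a => by
    have : T a a = 0 := by
      have h2 := h a a
      have : (2 : ℂ) • T a a = 0 := by
        rw [two_smul]
        nth_rewrite 2 [h2]
        exact add_neg_cancel _
      exact (smul_eq_zero.1 this).resolve_left two_ne_zero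
    rw [this]
    exact zero_mem _
  have hn : ∀ a b, T a b ∈ I → T b a ∈ I := fun a b hab => by
    rw [h]
    exact neg_mem hab
  fin_cases a <;> fin_cases b
  · exact hd _
  · exact h01
  · exact h02
  · exact hn _ _ h01
  · exact hd _
  · exact h12
  · exact hn _ _ h02
  · exact hn _ _ h12
  · exact hd _

/-- In three dimensions the Ricci tensor determines the Riemann tensor. -/
theorem linRiem_mem {I : Ideal Series} {k : MatS} (hs : ∀ a b, k a b = k b a)
    (h : ∀ a b, ∑ c, linRiem k c a c b ∈ I) (a b c d : Fin 3) : linRiem k a b c d ∈ I := by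
  have anti1 : ∀ a b c d, linRiem k a b c d = -linRiem k b a c d := fun a b c d => by
    simp only [linRiem]
    ring
  have anti2 : ∀ a b c d, linRiem k a b c d = -linRiem k a b d c := fun a b c d => by
    simp only [linRiem]
    ring
  have pair : ∀ a b c d, linRiem k a b c d = linRiem k c d a b := fun a b c d => by
    simp only [linRiem]
    rw [hs c b, hs d a, hs d b, hs c a, dS_comm d a, dS_comm c b, dS_comm c a, dS_comm d b]
    ring
  have diag1 : ∀ a c d, linRiem k a a c d = 0 := fun a c d => by
    simp only [linRiem]
    ring
  have diag2 : ∀ a b c, linRiem k a b c c = 0 := fun a b c => by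
    simp only [linRiem]
    ring
  have h' : ∀ a b, linRiem k 0 a 0 b + linRiem k 1 a 1 b + linRiem k 2 a 2 b ∈ I := by
    simpa only [Fin.sum_univ_three] using h
  have half : ∀ f : Series, 2 * f ∈ I → f ∈ I := fun f hf => by
    have := Ideal.mul_mem_left I (C (1 / 2)) hf
    rwa [← mul_assoc, C_half_mul_two, one_mul] at this
  have swap : ∀ a b c d, linRiem k a b c d = linRiem k b a d c := fun a b c d => by
    rw [anti1, anti2, neg_neg]
  -- contractions with `δ^{ab}`, expressed by the six independent components
  have h00 : linRiem k 0 1 0 1 + linRiem k 0 2 0 2 ∈ I := by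
    have := h' 0 0
    rwa [diag1, zero_add, swap 1 0, swap 2 0] at this
  have h11 : linRiem k 0 1 0 1 + linRiem k 1 2 1 2 ∈ I := by
    have := h' 1 1
    rwa [diag1, add_zero, swap 2 1] at this
  have h22 : linRiem k 0 2 0 2 + linRiem k 1 2 1 2 ∈ I := by
    have := h' 2 2
    rwa [diag1, add_zero] at this
  -- the three diagonal equations have an invertible matrix of coefficients
  have r0101 : linRiem k 0 1 0 1 ∈ I := half _ (by
    convert sub_mem (add_mem h00 h11) h22 using 1
    ring)
  have r0202 : linRiem k 0 2 0 2 ∈ I := (add_mem_cancel_left r0101).1 h00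
  have r1212 : linRiem k 1 2 1 2 ∈ I := (add_mem_cancel_left r0101).1 h11
  have r0212 : linRiem k 0 2 1 2 ∈ I := by
    have := h' 0 1
    rw [diag1, diag2, zero_add, zero_add, swap] at this
    exact this
  have r0112 : linRiem k 0 1 1 2 ∈ I := by
    have := h' 0 2
    rw [diag1, diag2, zero_add, add_zero, anti1] at this
    exact neg_mem_iff.1 this
  have r0102 : linRiem k 0 1 0 2 ∈ I := by
    have := h' 1 2
    rwa [diag1, diag2, add_zero, add_zero] at this
  refine mem_of_antisymm (T := fun a b => linRiem k a b c d) (fun a b => anti1 a b c d)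
    ?_ ?_ ?_ a b
  · exact mem_of_antisymm (anti2 0 1) r0101 r0102 r0112 c d
  · exact mem_of_antisymm (anti2 0 2) (by rwa [pair]) r0202 r0212 c d
  · exact mem_of_antisymm (anti2 1 2) (by rwa [pair]) (by rwa [pair]) r1212 c d

/-! ### The normal gauge -/

theorem euler_euler (f : Series) :
    euler (euler f) = euler f + ∑ a, ∑ c, X a * X c * dS a (dS c f) := by
  simp only [euler, map_sum, dS_mul, dS_X, ite_mul, one_mul, zero_mul, Finset.sum_add_distrib,
    mul_add, Finset.mul_sum, Finset.sum_ite_eq, Finset.mem_univ, if_true,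
    mul_assoc]

/-- In the normal gauge `k_{ab} x^b = 0` the component of the linearized Riemann tensor in two
radial directions is the perturbation itself, up to an invertible differential operator. -/
theorem sum_X_mul_linRiem {k : MatS} (hs : ∀ a b, k a b = k b a)
    (hX : ∀ d, ∑ a, X a * k a d = 0) (b d : Fin 3) :
    ∑ a, ∑ c, X a * X c * linRiem k a b c d = -(euler (euler (k b d)) + euler (k b d)) := by
  -- first and second derivatives of the gauge condition
  have e1 : ∀ b d, k b d + ∑ a, X a * dS b (k a d) = 0 := fun b d => by
    have := congrArg (dS b) (hX d)
    simpa only [map_sum, dS_mul, dS_X, ite_mul, one_mul, zero_mul, Finset.sum_add_distrib,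
      Finset.sum_ite_eq, Finset.mem_univ, if_true, map_zero] using this
  have e2 : ∀ b c d, dS c (k b d) + (dS b (k c d) + ∑ a, X a * dS c (dS b (k a d))) = 0 :=
    fun b c d => by
    have := congrArg (dS c) (e1 b d)
    simpa only [map_add, map_sum, dS_mul, dS_X, ite_mul, one_mul, zero_mul,
      Finset.sum_add_distrib, Finset.sum_ite_eq, Finset.mem_univ, if_true, map_zero] using this
  have t1 : ∀ b d, ∑ a, ∑ c, X a * X c * dS b (dS c (k a d)) = k b d - euler (k b d) :=
    fun b d => by
    have h := e2 b
    have h1 := e1 b d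
    simp only [Fin.sum_univ_three, euler, dS_comm b] at h h1 ⊢
    linear_combination X 0 * h 0 d + X 1 * h 1 d + X 2 * h 2 d - h1
  have t2 : ∑ a, ∑ c, X a * X c * dS a (dS d (k b c)) = k b d - euler (k b d) := by
    rw [Finset.sum_comm, hs b d, ← t1 d b]
    refine Finset.sum_congr rfl fun a _ => Finset.sum_congr rfl fun c _ => ?_
    rw [hs b a, dS_comm d c]
    ring
  have t4 : ∑ a, ∑ c, X a * X c * dS b (dS d (k a c)) = k b d + k b d := by
    have h : ∀ c, dS b (k c d) + (dS d (k c b) + ∑ a, X a * dS b (dS d (k a c))) = 0 :=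
      fun c => by
      rw [hs c d, hs c b]
      exact e2 d b c
    have h1 := e1 b d
    have h2 := e1 d b
    rw [hs d b] at h2
    simp only [Fin.sum_univ_three] at h h1 h2 ⊢
    linear_combination X 0 * h 0 + X 1 * h 1 + X 2 * h 2 - h1 - h2
  have t3 := euler_euler (k b d)
  have split : ∑ a, ∑ c, X a * X c * linRiem k a b c d
      = ∑ a, ∑ c, X a * X c * dS b (dS c (k a d)) + ∑ a, ∑ c, X a * X c * dS a (dS d (k b c))
        - ∑ a, ∑ c, X a * X c * dS a (dS c (k b d))
        - ∑ a, ∑ c, X a * X c * dS b (dS d (k a c)) := by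
    simp only [← Finset.sum_add_distrib, ← Finset.sum_sub_distrib, linRiem, mul_add, mul_sub]
  rw [split, t1, t2, t4]
  linear_combination t3

/-- The Gauss lemma for the difference of two metrics in the same normal coordinates: if the
lowered Christoffel symbols of `k` of the first kind vanish in radial directions, so does `k`. -/
theorem sum_X_mul_eq_zero {k : MatS} (hs : ∀ a b, k a b = k b a)
    (h0 : ∀ a b, k a b ∈ vanish 1)
    (hg : ∀ a, ∑ b, ∑ d, (dS b (k a d) + dS d (k a b) - dS a (k b d)) * X b * X d = 0)
    (d : Fin 3) : ∑ a, X a * k a d = 0 := by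
  set g : Fin 3 → Series := fun d => ∑ a, X a * k a d with hgdef
  set N : Series := ∑ d, X d * g d with hN
  have hdg : ∀ b d, dS b (g d) = k b d + ∑ a, X a * dS b (k a d) := fun b d => by
    simp only [hgdef, map_sum, dS_mul, dS_X, ite_mul, one_mul, zero_mul, Finset.sum_add_distrib,
      Finset.sum_ite_eq, Finset.mem_univ, if_true]
  have hdN : ∀ b, dS b N = g b + ∑ d, X d * dS b (g d) := fun b => by
    simp only [hN, map_sum, dS_mul, dS_X, ite_mul, one_mul, zero_mul, Finset.sum_add_distrib,
      Finset.sum_ite_eq, Finset.mem_univ, if_true]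
  have hE : ∀ a, 2 * euler (g a) = dS a N := fun a => by
    have h := hg a
    rw [hdN]
    simp only [euler, hdg, Fin.sum_univ_three] at h ⊢
    simp only [hgdef, Fin.sum_univ_three] at h ⊢
    fin_cases a <;>
    simp only [Fin.zero_eta, Fin.mk_one, Fin.reduceFinMk, hs 1 0, hs 2 0, hs 2 1] at h ⊢ <;>
    linear_combination h
  -- `E N = 2 N`, so that `N = k_{ab} x^a x^b`, which has no terms of degree two, is zero
  have hEN : euler N = 2 * N := by
    have h1 : euler N = N + ∑ d, X d * euler (g d) := by
      simp only [euler, hdN, Fin.sum_univ_three]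
      simp only [hN, Fin.sum_univ_three]
      ring
    have h2 : euler N = 2 * ∑ d, X d * euler (g d) := by
      rw [euler, Finset.mul_sum]
      refine Finset.sum_congr rfl fun a _ => ?_
      rw [← hE]
      ring
    linear_combination 2 * h1 - h2
  have hg2 : ∀ d, g d ∈ vanish 2 := fun d =>
    sum_mem fun a _ => mul_mem_vanish (X_mem_vanish a) (h0 a d) (by norm_num)
  have hN0 : N = 0 := eq_zero_of_euler_eq_two_mul
    (sum_mem fun a _ => mul_mem_vanish (X_mem_vanish a) (hg2 a) (by norm_num)) hEN
  have hEg := hE d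
  rw [hN0, map_zero, mul_eq_zero] at hEg
  exact eq_zero_of_euler_eq_zero (mem_vanish_one.1 (vanish_of_le (by norm_num) (hg2 d)))
    (hEg.resolve_left two_ne_zero_series)

/-! ### Two solutions to increasing order -/

theorem sum_mul_chrS {H G : MatS} (hG : G * H = 1) (e b c : Fin 3) :
    ∑ a, H e a * chrS H G a b c
      = C (1 / 2) * (dS b (H e c) + dS c (H e b) - dS e (H b c)) := by
  have hG2 : H * G = 1 := mul_eq_one_comm.1 hG
  have h1 : ∀ d, ∑ a, H e a * G a d = if e = d then 1 else 0 := fun d => by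
    rw [← Matrix.mul_apply, hG2, Matrix.one_apply]
  have h2 : ∑ a, H e a * chrS H G a b c = C (1 / 2) * ∑ d, (∑ a, H e a * G a d) *
      (dS b (H d c) + dS c (H d b) - dS d (H b c)) := by
    simp only [chrS, Finset.mul_sum, Finset.sum_mul]
    rw [Finset.sum_comm]
    refine Finset.sum_congr rfl fun a _ => Finset.sum_congr rfl fun d _ => ?_
    ring
  rw [h2]
  simp only [h1, ite_mul, one_mul, zero_mul, Finset.sum_ite_eq, Finset.mem_univ, if_true]

/-- The geodesic equation with its free index lowered is linear in the metric. -/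
theorem geodesic_lowered {H G : MatS} (hG : G * H = 1)
    (hg : ∀ a, ∑ b, ∑ d, chrS H G a b d * X b * X d = 0) (a : Fin 3) :
    ∑ b, ∑ d, (dS b (H a d) + dS d (H a b) - dS a (H b d)) * X b * X d = 0 := by
  have h1 : ∑ e, H a e * ∑ b, ∑ d, chrS H G e b d * X b * X d = 0 := by
    simp only [hg, mul_zero, Finset.sum_const_zero]
  have h2 : ∑ e, H a e * ∑ b, ∑ d, chrS H G e b d * X b * X d
      = ∑ b, ∑ d, (∑ e, H a e * chrS H G e b d) * X b * X d := by
    simp only [Finset.mul_sum, Finset.sum_mul]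
    rw [Finset.sum_comm]
    refine Finset.sum_congr rfl fun b _ => ?_
    rw [Finset.sum_comm]
    refine Finset.sum_congr rfl fun d _ => Finset.sum_congr rfl fun e _ => ?_
    ring
  rw [h2] at h1
  simp only [sum_mul_chrS hG, mul_assoc, ← Finset.mul_sum] at h1
  simp only [mul_assoc]
  have := congrArg (fun f => 2 * f) h1
  simp only [mul_zero] at this
  rwa [← mul_assoc, mul_comm 2, C_half_mul_two, one_mul] at this

section Comparison

variable {μ : ℂ} {H G Q K H' G' Q' K' : MatS} {Z S Z' S' : Series}

theorem IsFormalSolution.sub_mem_vanish_one (s : IsFormalSolution μ H G Z S Q K)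
    (s' : IsFormalSolution μ H' G' Z' S' Q' K') (a b : Fin 3) : H' a b - H a b ∈ vanish 1 := by
  rw [mem_vanish_one, map_sub, s.H_zero, s'.H_zero, sub_self]

theorem IsFormalSolution.Z_mem_vanish_two (s : IsFormalSolution μ H G Z S Q K) :
    Z ∈ vanish 2 :=
  mem_vanish_succ s.Z_zero fun a => mem_vanish_one.2 (s.dZ_zero a)

theorem IsFormalSolution.dZ_mem_vanish_one (s : IsFormalSolution μ H G Z S Q K) (a : Fin 3) :
    dS a Z ∈ vanish 1 :=
  mem_vanish_one.2 (s.dZ_zero a)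

/-- The tensor `s_{ab}` to order `k` determines the metric to order `k + 2`. -/
theorem metric_sub_mem_vanish (s : IsFormalSolution μ H G Z S Q K)
    (s' : IsFormalSolution μ H' G' Z' S' Q' K') {k : ℕ}
    (hH : ∀ a b, H' a b - H a b ∈ vanish (k + 1)) (hQ : ∀ a b, Q' a b - Q a b ∈ vanish k)
    (a b : Fin 3) : H' a b - H a b ∈ vanish (k + 2) := by
  have hs : ∀ a b, (H' - H) a b = (H' - H) b a := fun a b => by
    rw [Matrix.sub_apply, Matrix.sub_apply, s.H_symm, s'.H_symm]
  have hX : ∀ d, ∑ a, X a * (H' - H) a d = 0 := by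
    refine sum_X_mul_eq_zero hs (fun a b => s.sub_mem_vanish_one s' a b) fun a => ?_
    have h1 := geodesic_lowered s.G_mul s.geodesic a
    have h2 := geodesic_lowered s'.G_mul s'.geodesic a
    rw [← sub_zero (0 : Series)]
    nth_rewrite 1 [← h2]
    rw [← h1]
    simp only [← Finset.sum_sub_distrib, Matrix.sub_apply, map_sub]
    refine Finset.sum_congr rfl fun b _ => Finset.sum_congr rfl fun d _ => ?_
    ring
  have hR : ∀ a b, ∑ c, linRiem (H' - H) c a c b ∈ vanish k := fun a b => by
    have h1 := ricciS_sub_add_mem_vanish s.G_mul s'.G_mul s.H_symm s'.H_symm s'.H_zero hH a b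
    rw [s.ricci_eq, s'.ricci_eq] at h1
    have h2 := (add_mem_cancel_left (hQ a b)).1 h1
    exact (C_mul_mem_vanish_iff (by norm_num)).1 h2
  have hL := linRiem_mem hs hR
  refine mem_vanish_of_euler_euler_add_mem
    (mem_vanish_one.1 (s.sub_mem_vanish_one s' a b)) ?_
  have h1 := sum_X_mul_linRiem hs hX a b
  have h2 : ∑ c, ∑ d, X c * X d * linRiem (H' - H) c a d b ∈ vanish (k + 2) :=
    sum_mem fun c _ => sum_mem fun d _ => mul_mem_vanish
      (mul_mem_vanish (l := 2) (X_mem_vanish c) (X_mem_vanish d) le_rfl) (hL c a d b) (by omega)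
  rw [h1] at h2
  exact neg_mem_iff.1 h2

theorem one_sub_sub_mem_vanish {l : ℕ} (hZ : Z' - Z ∈ vanish l) :
    1 - C μ * Z' - (1 - C μ * Z) ∈ vanish l := by
  have : 1 - C μ * Z' - (1 - C μ * Z) = -(C μ * (Z' - Z)) := by ring
  rw [this]
  exact neg_mem (Ideal.mul_mem_left _ _ hZ)

/-- The order of `δs_{ab}` is raised by one because `D_a ζ` vanishes at `i`. -/
theorem s_sub_mem_vanish (s : IsFormalSolution μ H G Z S Q K)
    (s' : IsFormalSolution μ H' G' Z' S' Q' K') {k : ℕ}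
    (hH : ∀ a b, H' a b - H a b ∈ vanish (k + 1)) (hQ : ∀ a b, Q' a b - Q a b ∈ vanish k)
    (hZ : Z' - Z ∈ vanish (k + 2)) : S' - S ∈ vanish (k + 2) := by
  refine mem_vanish_succ (by rw [map_sub, s.S_zero, s'.S_zero, sub_self]) fun a => ?_
  rw [map_sub, eq_neg_of_add_eq_zero_left (s.ds_eq a), eq_neg_of_add_eq_zero_left (s'.ds_eq a),
    ← neg_sub', neg_mem_iff]
  have hG := inverse_sub_mem_vanish s.G_mul s'.G_mul hH
  refine sub_mul_mem_vanish_of_eq (one_sub_sub_mem_vanish (vanish_of_le (by omega) hZ))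
    (sub_sum_mem_vanish fun b => ?_)
  have h1 : ∀ b, ∑ d, G' b d * dS d Z' ∈ vanish 1 := fun b =>
    sum_mem fun d _ => Ideal.mul_mem_left _ _ (s'.dZ_mem_vanish_one d)
  refine sub_mul_mem_vanish (hQ a b) (h1 b) (mem_vanish_zero _) (sub_sum_mem_vanish fun d => ?_)
    le_rfl (zero_add _).ge
  exact sub_mul_mem_vanish_of_eq (hG b d) (dS_sub_mem_vanish hZ d le_rfl)

theorem zeta_sub_mem_vanish (s : IsFormalSolution μ H G Z S Q K)
    (s' : IsFormalSolution μ H' G' Z' S' Q' K') {k : ℕ}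
    (hH : ∀ a b, H' a b - H a b ∈ vanish (k + 1)) (hQ : ∀ a b, Q' a b - Q a b ∈ vanish k)
    (hZ : Z' - Z ∈ vanish (k + 2)) (hS : S' - S ∈ vanish (k + 1)) :
    Z' - Z ∈ vanish (k + 3) := by
  refine mem_vanish_succ (by rw [map_sub, s.Z_zero, s'.Z_zero, sub_self]) fun b => ?_
  refine mem_vanish_succ (by rw [map_sub, map_sub, s.dZ_zero, s'.dZ_zero, sub_self]) fun a => ?_
  have h1 := s.hess_eq a b
  have h1' := s'.hess_eq a b
  rw [covS_covS_scalarS] at h1 h1'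
  have e : dS a (dS b (Z' - Z)) = (∑ d, chrS H' G' d a b * dS d Z' - ∑ d, chrS H G d a b * dS d Z)
      + (S' * H' a b - S * H a b)
      - (Z' * (1 - C μ * Z') * Q' a b - Z * (1 - C μ * Z) * Q a b) := by
    rw [map_sub, map_sub]
    linear_combination h1' - h1
  rw [e]
  refine sub_mem (add_mem (sub_sum_mem_vanish fun d => ?_) ?_) ?_
  · exact sub_mul_mem_vanish (chrS_sub_mem_vanish s.G_mul s'.G_mul hH d a b)
      (s'.dZ_mem_vanish_one d) (mem_vanish_zero _) (dS_sub_mem_vanish hZ d le_rfl)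
      le_rfl (zero_add _).ge
  · exact sub_mul_mem_vanish_of_eq hS (hH a b)
  · have hZ1 := vanish_of_le (Nat.le_succ _) hZ
    refine sub_mul_mem_vanish (q := 1)
      (sub_mul_mem_vanish_of_eq hZ1 (one_sub_sub_mem_vanish hZ1)) (mem_vanish_zero _) ?_
      (hQ a b) (by omega) (by omega)
    exact Ideal.mul_mem_right _ _ (vanish_of_le (by norm_num) s.Z_mem_vanish_two)

/-- The equation for `D_{[c} s_{a]b}` shows that the leading terms of the difference of two tensors
`s_{ab}` are curl free. -/
theorem curl_sub_mem_vanish (s : IsFormalSolution μ H G Z S Q K)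
    (s' : IsFormalSolution μ H' G' Z' S' Q' K') {k : ℕ}
    (hH : ∀ a b, H' a b - H a b ∈ vanish (k + 1)) (hQ : ∀ a b, Q' a b - Q a b ∈ vanish k)
    (hZ : Z' - Z ∈ vanish (k + 2)) (c a b : Fin 3) :
    dS c (Q' a b - Q a b) - dS a (Q' c b - Q c b) ∈ vanish k := by
  -- a derivative lowers the order by one, so that `k = 0` is separate
  rcases k with _ | k
  · exact mem_vanish_zero _
  have hΓ := chrS_sub_mem_vanish s.G_mul s'.G_mul hH
  have hG := inverse_sub_mem_vanish s.G_mul s'.G_mul hH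
  have hcov : ∀ c a b, covS (chrS H' G') (matTS Q') ![c, a, b]
      - covS (chrS H G) (matTS Q) ![c, a, b] - dS c (Q' a b - Q a b) ∈ vanish (k + 1) := by
    intro c a b
    have e : covS (chrS H' G') (matTS Q') ![c, a, b]
        - covS (chrS H G) (matTS Q) ![c, a, b] - dS c (Q' a b - Q a b)
        = -((∑ d, chrS H' G' d c a * Q' d b - ∑ d, chrS H G d c a * Q d b)
          + (∑ d, chrS H' G' d c b * Q' a d - ∑ d, chrS H G d c b * Q a d)) := by
      rw [covS_matTS, covS_matTS, map_sub]
      ring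
    rw [e]
    exact neg_mem (add_mem
      (sub_sum_mem_vanish fun d => sub_mul_mem_vanish_of_eq (hΓ _ _ _) (hQ _ _))
      (sub_sum_mem_vanish fun d => sub_mul_mem_vanish_of_eq (hΓ _ _ _) (hQ _ _)))
  have hdZ : ∀ a, dS a Z' - dS a Z ∈ vanish (k + 1) := fun a =>
    dS_sub_mem_vanish hZ a (Nat.le_succ _)
  have hW := sub_add_mem_vanish (sub_sub_mem_vanish (sub_mul_mem_vanish_of_eq (hdZ c) (hQ a b))
      (sub_mul_mem_vanish_of_eq (hdZ a) (hQ c b)))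
    (sub_sum_mem_vanish (s := Finset.univ) fun d => sub_mul_mem_vanish_of_eq
      (sub_sum_mem_vanish (s := Finset.univ) fun e => sub_mul_mem_vanish_of_eq
        (vanish_of_le (Nat.le_succ _) (hG d e)) (hdZ e))
      (sub_mul_mem_vanish_of_eq (sub_self_mem_vanish (C (1 / 2)) _)
        (sub_sub_mem_vanish
          (sub_mul_mem_vanish_of_eq (hQ d c) (vanish_of_le (Nat.le_succ _) (hH a b)))
          (sub_mul_mem_vanish_of_eq (hQ d a) (vanish_of_le (Nat.le_succ _) (hH c b))))))
  have h1 := s.cotton_eq c a b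
  have h1' := s'.cotton_eq c a b
  have hD1 := hcov c a b
  have hD2 := hcov a c b
  set V := covS (chrS H G) (matTS Q) ![c, a, b] - covS (chrS H G) (matTS Q) ![a, c, b]
  set V' := covS (chrS H' G') (matTS Q') ![c, a, b] - covS (chrS H' G') (matTS Q') ![a, c, b]
  set D := dS c (Q' a b - Q a b) - dS a (Q' c b - Q c b) with hD
  have hVD : V' - V - D ∈ vanish (k + 1) := by
    convert sub_mem hD1 hD2 using 1
    ring
  have hDk : D ∈ vanish k := sub_mem (dS_mem_vanish (hQ _ _) _ le_rfl)
    (dS_mem_vanish (hQ _ _) _ le_rfl)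
  have hVk : V' - V ∈ vanish k := by
    have := add_mem (vanish_of_le (Nat.le_succ _) hVD) hDk
    rwa [sub_add_cancel] at this
  have hdiff : (1 - C μ * Z') * (C (1 / 2) * V') - (1 - C μ * Z) * (C (1 / 2) * V)
      ∈ vanish (k + 1) := by
    rw [sub_eq_zero.1 h1, sub_eq_zero.1 h1', ← mul_sub]
    exact Ideal.mul_mem_left _ _ hW
  -- `1 - μ ζ` differs from `1` by terms of order two, which makes up for `δV` being known only to
  -- order `k`
  have e : D = -(V' - V - D) + (2 * ((1 - C μ * Z') * (C (1 / 2) * V')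
      - (1 - C μ * Z) * (C (1 / 2) * V)) + (C μ * (Z' - Z) * V + C μ * (Z' * (V' - V)))) := by
    have h2 := C_half_mul_two
    linear_combination (-(1 - C μ * Z') * V' + (1 - C μ * Z) * V) * h2
  rw [e]
  refine add_mem (neg_mem hVD) (add_mem (Ideal.mul_mem_left _ _ hdiff) (add_mem ?_ ?_))
  · exact Ideal.mul_mem_right _ _ (Ideal.mul_mem_left _ _ (vanish_of_le (by omega) hZ))
  · exact Ideal.mul_mem_left _ _ (mul_mem_vanish s'.Z_mem_vanish_two hVk (by omega))

/-- The leading terms of the difference of two tensors `s_{ab}` are trace free with respect to the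
flat metric. -/
theorem trace_sub_mem_vanish (s : IsFormalSolution μ H G Z S Q K)
    (s' : IsFormalSolution μ H' G' Z' S' Q' K') {k : ℕ}
    (hH : ∀ a b, H' a b - H a b ∈ vanish (k + 1)) (hQ : ∀ a b, Q' a b - Q a b ∈ vanish k) :
    ∑ a, (Q' a a - Q a a) ∈ vanish (k + 1) := by
  have hG := inverse_sub_mem_vanish s.G_mul s'.G_mul hH
  have e : ∑ a, (Q' a a - Q a a) = ∑ a, ∑ b, ((G' a b + if a = b then 1 else 0)
      * (Q' a b - Q a b) + (G' a b - G a b) * Q a b)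
      - (∑ a, ∑ b, G' a b * Q' a b - ∑ a, ∑ b, G a b * Q a b) := by
    rw [← Finset.sum_sub_distrib, ← Finset.sum_sub_distrib]
    refine Finset.sum_congr rfl fun a _ => ?_
    rw [← Finset.sum_sub_distrib, ← Finset.sum_sub_distrib]
    have : Q' a a - Q a a = ∑ b, (if a = b then 1 else 0) * (Q' a b - Q a b) := by
      simp only [ite_mul, one_mul, zero_mul, Finset.sum_ite_eq, Finset.mem_univ, if_true]
    rw [this]
    refine Finset.sum_congr rfl fun b _ => ?_
    ring
  rw [e, s.Q_trace, s'.Q_trace, sub_zero, sub_zero]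
  refine sum_mem fun a _ => sum_mem fun b _ => add_mem ?_ ?_
  · exact mul_mem_vanish (inverse_add_mem_vanish s'.G_mul s'.H_zero a b) (hQ a b) (by omega)
  · exact Ideal.mul_mem_right _ _ (hG a b)

/-- To leading order the difference of the `j`-th covariant derivatives of two tensors is the
`j`-th partial derivative of their difference. -/
theorem iterCovS_sub_sub_iterDS_mem_vanish {Γ Γ' : Fin 3 → Fin 3 → Fin 3 → Series} {n k : ℕ}
    {T T' : TensS n} (hΓ : ∀ a b c, Γ' a b c - Γ a b c ∈ vanish k)
    (hT : ∀ i, T' i - T i ∈ vanish k) (j m : ℕ) (hjm : j + m = k + 1) (i : Fin (n + j) → Fin 3) :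
    iterCovS Γ' T' j i - iterCovS Γ T j i - iterDS (T' - T) j i ∈ vanish m := by
  have hD : ∀ j m, j + m ≤ k → ∀ i, iterDS (T' - T) j i ∈ vanish m := by
    intro j
    induction j with
    | zero => exact fun m hm i => vanish_of_le (by omega) (hT i)
    | succ j ih => exact fun m hm i => dS_mem_vanish (ih (m + 1) (by omega) _) _ le_rfl
  induction j generalizing m with
  | zero =>
    have : iterCovS Γ' T' 0 i - iterCovS Γ T 0 i - iterDS (T' - T) 0 i = 0 := by
      simp only [iterCovS, iterDS, Pi.sub_apply]
      exact sub_self _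
    rw [this]
    exact zero_mem _
  | succ j ih =>
    have h1 := fun i => ih (m + 1) (by omega) i
    have h2 : ∀ i, iterCovS Γ' T' j i - iterCovS Γ T j i ∈ vanish m := fun i => by
      have := add_mem (vanish_of_le (Nat.le_succ m) (h1 i)) (hD j m (by omega) i)
      rwa [sub_add_cancel] at this
    have h3 : ∀ l, ∑ d, Γ' d (i 0) (i (Fin.succ l)) *
          iterCovS Γ' T' j (Function.update (Fin.tail i) l d)
        - ∑ d, Γ d (i 0) (i (Fin.succ l)) *
          iterCovS Γ T j (Function.update (Fin.tail i) l d) ∈ vanish m := fun l =>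
      sub_sum_mem_vanish fun d => sub_mul_mem_vanish_of_eq
        (vanish_of_le (by omega) (hΓ _ _ _)) (h2 _)
    have h4 := sub_sum_mem_vanish (s := Finset.univ) h3
    have h5 := dS_mem_vanish (h1 (Fin.tail i)) (i 0) (l := m) le_rfl
    rw [map_sub, map_sub] at h5
    convert sub_mem h5 h4 using 1
    simp only [iterCovS, covS, iterDS]
    ring

end Comparison

/-! ### Potentials of curl free tensors -/

/-- A symmetric tensor whose terms of lowest degree `k` are curl free is to leading order the
Hessian of a function. -/
theorem exists_potential {T : MatS} {k : ℕ} (hs : ∀ a b, T a b = T b a)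
    (hT : ∀ a b, T a b ∈ vanish k) (hc : ∀ c a b, dS c (T a b) - dS a (T c b) ∈ vanish k) :
    ∃ φ : Series, ∀ c d, T c d - dS c (dS d φ) ∈ vanish (k + 1) := by
  -- by Euler's formula `x^a x^b T_{ab}` is `(k + 2) (k + 1)` times the potential
  set w : Fin 3 → Series := fun c => ∑ b, X b * T c b with hw
  set φ : Series := ∑ a, X a * w a with hφ
  have hdw : ∀ d c, dS d (w c) = T c d + ∑ b, X b * dS d (T c b) := fun d c => by
    simp only [hw, map_sum, dS_mul, dS_X, ite_mul, one_mul, zero_mul, Finset.sum_add_distrib,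
      Finset.sum_ite_eq, Finset.mem_univ, if_true]
  have hdw' : ∀ d c, dS d (w c) - C ((k : ℂ) + 1) * T c d ∈ vanish (k + 1) := fun d c => by
    have e : dS d (w c) - C ((k : ℂ) + 1) * T c d = ∑ b, X b * (dS d (T b c) - dS b (T d c))
        + (euler (T c d) - C (k : ℂ) * T c d) := by
      have h1 : ∀ b, T c b = T b c := fun b => hs c b
      simp only [hdw, mul_sub, Finset.sum_sub_distrib, euler, map_add, map_one, h1]
      ring
    rw [e]
    refine add_mem (sum_mem fun b _ => mul_mem_vanish (X_mem_vanish b) (hc d b c) (by omega))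
      (euler_sub_mem_vanish (hT c d))
  have hdφ : ∀ c, dS c φ - C ((k : ℂ) + 2) * w c ∈ vanish (k + 2) := fun c => by
    have h1 : dS c φ = w c + ∑ a, X a * dS c (w a) := by
      simp only [hφ, map_sum, dS_mul, dS_X, ite_mul, one_mul, zero_mul, Finset.sum_add_distrib,
        Finset.sum_ite_eq, Finset.mem_univ, if_true]
    have e : dS c φ - C ((k : ℂ) + 2) * w c
        = ∑ a, X a * (dS c (w a) - C ((k : ℂ) + 1) * T a c) := by
      simp only [h1, mul_sub, Finset.sum_sub_distrib]
      have h2 : ∑ a, X a * (C ((k : ℂ) + 1) * T a c) = C ((k : ℂ) + 1) * w c := by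
        rw [hw, Finset.mul_sum]
        refine Finset.sum_congr rfl fun a _ => ?_
        rw [hs a c]
        ring
      have h3 : (C ((k : ℂ) + 2) : Series) = C ((k : ℂ) + 1) + 1 := by
        rw [← map_one C, ← map_add]
        congr 1
        ring
      rw [h2, h3]
      ring
    rw [e]
    exact sum_mem fun a _ => mul_mem_vanish (X_mem_vanish a) (hdw' c a) (by omega)
  have hk1 : (k : ℂ) + 1 ≠ 0 := Nat.cast_add_one_ne_zero k
  have hk2 : (k : ℂ) + 2 ≠ 0 := by exact_mod_cast (by omega : k + 2 ≠ 0)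
  refine ⟨C (((k : ℂ) + 2) * ((k : ℂ) + 1))⁻¹ * φ, fun c d => ?_⟩
  rw [← C_mul_mem_vanish_iff (mul_ne_zero hk2 hk1)]
  have e : C (((k : ℂ) + 2) * ((k : ℂ) + 1)) * (T c d
      - dS c (dS d (C (((k : ℂ) + 2) * ((k : ℂ) + 1))⁻¹ * φ)))
      = -(C ((k : ℂ) + 2) * (dS c (w d) - C ((k : ℂ) + 1) * T d c)
        + dS c (dS d φ - C ((k : ℂ) + 2) * w d)) := by
    have h1 : (C (((k : ℂ) + 2) * ((k : ℂ) + 1)) : Series)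
        * C (((k : ℂ) + 2) * ((k : ℂ) + 1))⁻¹ = 1 := by
      rw [← map_mul, mul_inv_cancel₀ (mul_ne_zero hk2 hk1), map_one]
    simp only [dS_mul, dS_C, zero_mul, zero_add, map_sub, hs d c]
    rw [mul_sub, ← mul_assoc, h1, map_mul]
    ring
  rw [e]
  exact neg_mem (add_mem (Ideal.mul_mem_left _ _ (hdw' c d))
    (dS_mem_vanish (hdφ d) c le_rfl))

/-- The partial derivative of order `s` at the origin, in multi-index notation. -/
noncomputable def derivAtZero (f : Series) (s : Fin 3 →₀ ℕ) : ℂ :=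
  (∏ a, ((s a).factorial : ℂ)) * coeff s f

theorem derivAtZero_zero (f : Series) : derivAtZero f 0 = constantCoeff f := by
  simp [derivAtZero]

theorem derivAtZero_dS (f : Series) (a : Fin 3) (s : Fin 3 →₀ ℕ) :
    derivAtZero (dS a f) s = derivAtZero f (s + Finsupp.single a 1) := by
  have h : ∏ b, (((s + Finsupp.single a 1 : Fin 3 →₀ ℕ) b).factorial : ℂ)
      = (s a + 1) * ∏ b, ((s b).factorial : ℂ) := by
    rw [← Finset.mul_prod_erase _ _ (Finset.mem_univ a),
      ← Finset.mul_prod_erase Finset.univ (fun b => ((s b).factorial : ℂ)) (Finset.mem_univ a),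
      Finset.prod_congr rfl (g := fun b => ((s b).factorial : ℂ)), ← mul_assoc]
    · congr 1
      rw [Finsupp.add_apply, Finsupp.single_eq_same, Nat.factorial_succ]
      push_cast
      rfl
    · intro b hb
      rw [Finsupp.add_apply, Finsupp.single_eq_of_ne (Finset.ne_of_mem_erase hb), add_zero]
  rw [derivAtZero, derivAtZero, h, coeff_pderiv]
  ring

theorem derivAtZero_add (f g : Series) (s : Fin 3 →₀ ℕ) :
    derivAtZero (f + g) s = derivAtZero f s + derivAtZero g s := by
  simp only [derivAtZero, map_add, mul_add]

theorem derivAtZero_eq_zero {f : Series} {k : ℕ} (hf : f ∈ vanish k) {s : Fin 3 →₀ ℕ}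
    (hs : s.degree < k) : derivAtZero f s = 0 := by
  rw [derivAtZero, mem_vanish.1 hf s hs, mul_zero]

/-- All indices of the iterated derivative of a Hessian enter through their multi-index. -/
theorem derivAtZero_iterDS {T : TensS 2} {φ : Series} (hT : ∀ i, T i = dS (i 0) (dS (i 1) φ))
    (p : ℕ) (i : Fin (2 + p) → Fin 3) (s : Fin 3 →₀ ℕ) :
    derivAtZero (iterDS T p i) s = derivAtZero φ (s + ∑ j, Finsupp.single (i j) 1) := by
  induction p generalizing s with
  | zero =>
    change derivAtZero (T i) s = derivAtZero φ (s + ∑ j : Fin 2, Finsupp.single (i j) 1)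
    rw [hT, derivAtZero_dS, derivAtZero_dS, Fin.sum_univ_two, add_assoc]
  | succ p ih =>
    change derivAtZero (dS (i 0) (iterDS T p (Fin.tail i))) s
      = derivAtZero φ (s + ∑ j : Fin ((2 + p) + 1), Finsupp.single (i j) 1)
    rw [derivAtZero_dS, ih, Fin.sum_univ_succ, add_assoc]
    rfl

/-! ### Space spinors of tensors -/

/-- Spinor indices of different pairs can be summed independently. -/
theorem sum_prod_spinorIndex {p : ℕ} (g : Fin p → Fin 2 → Fin 2 → ℂ) :
    ∑ A : Fin p × Fin 2 → Fin 2, ∏ j, g j (A (j, 0)) (A (j, 1)) = ∏ j, ∑ u, ∑ v, g j u v := by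
  have h1 : ∀ j, ∑ u, ∑ v, g j u v = ∑ w : Fin 2 → Fin 2, g j (w 0) (w 1) := fun j => by
    rw [← Fintype.sum_prod_type', ← (finTwoArrowEquiv (Fin 2)).sum_comp]
    rfl
  simp only [h1]
  rw [Finset.prod_univ_sum, Fintype.piFinset_univ,
    ← (Equiv.curry (Fin p) (Fin 2) (Fin 2)).sum_comp]
  rfl

theorem vdW_symm (a : Fin 3) (u v : Fin 2) : vdW a u v = vdW a v u := by
  fin_cases a <;> fin_cases u <;> fin_cases v <;> simp [vdW]

theorem sqrt_half_sq : (((1 / Real.sqrt 2 : ℝ) : ℂ)) * ((1 / Real.sqrt 2 : ℝ) : ℂ) = 1 / 2 := by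
  rw [← Complex.ofReal_mul, div_mul_div_comm, one_mul, Real.mul_self_sqrt (by norm_num)]
  norm_num

/-- The complex conjugate van der Waerden symbols form the dual basis. -/
theorem sum_conj_vdW_mul_vdW (a b : Fin 3) :
    ∑ u, ∑ v, starRingEnd ℂ (vdW b u v) * vdW a u v = if a = b then 1 else 0 := by
  have h := sqrt_half_sq
  have hI := Complex.I_mul_I
  set κ : ℂ := ((1 / Real.sqrt 2 : ℝ) : ℂ) with hκ
  have hc : starRingEnd ℂ κ = κ := Complex.conj_ofReal _
  fin_cases a <;> fin_cases b <;>
    simp [vdW, Fin.sum_univ_two, ← hκ, -one_div, -Complex.ofReal_div, hc]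
  · linear_combination 2 * h
  · linear_combination -2 * κ * κ * hI + 2 * h
  · linear_combination 2 * h

/-- The van der Waerden symbols change sign under the conjugation of space spinors, which is the
origin of the factor `(-1)^p` in the reality condition. -/
theorem conj_vdW (a : Fin 3) (u v : Fin 2) :
    ∑ u', ∑ v', tau u u' * tau v v' * starRingEnd ℂ (vdW a u' v') = -vdW a u v := by
  fin_cases a <;> fin_cases u <;> fin_cases v <;> simp [vdW, tau, Fin.sum_univ_two]

/-- A tensor is determined by its space spinor. -/
theorem eq_zero_of_toSpinor_eq_zero {p : ℕ} {T : Tens p} (h : toSpinor T = 0) : T = 0 := by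
  funext b
  have h1 : ∑ A : Fin p × Fin 2 → Fin 2,
      (∏ j, starRingEnd ℂ (vdW (b j) (A (j, 0)) (A (j, 1)))) * toSpinor T A = T b := by
    simp only [toSpinor, Finset.mul_sum]
    rw [Finset.sum_comm]
    have h2 : ∀ a : Fin p → Fin 3, ∑ A : Fin p × Fin 2 → Fin 2,
        (∏ j, starRingEnd ℂ (vdW (b j) (A (j, 0)) (A (j, 1)))) *
          (T a * ∏ j, vdW (a j) (A (j, 0)) (A (j, 1))) = if a = b then T a else 0 := fun a => by
      have h3 : ∀ A : Fin p × Fin 2 → Fin 2,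
          (∏ j, starRingEnd ℂ (vdW (b j) (A (j, 0)) (A (j, 1)))) *
          (T a * ∏ j, vdW (a j) (A (j, 0)) (A (j, 1)))
          = T a * ∏ j, (starRingEnd ℂ (vdW (b j) (A (j, 0)) (A (j, 1))) *
            vdW (a j) (A (j, 0)) (A (j, 1))) := fun A => by
        rw [Finset.prod_mul_distrib]
        ring
      simp only [h3, ← Finset.mul_sum]
      rw [sum_prod_spinorIndex (fun j u v => starRingEnd ℂ (vdW (b j) u v) * vdW (a j) u v)]
      simp only [sum_conj_vdW_mul_vdW]
      split_ifs with hab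
      · simp [hab]
      · obtain ⟨j, hj⟩ := Function.ne_iff.1 hab
        rw [Finset.prod_eq_zero (Finset.mem_univ j) (if_neg hj), mul_zero]
    simp only [h2, Finset.sum_ite_eq', Finset.mem_univ, if_true]
  rw [← h1, h]
  simp

/-- Averaging over one of the indices. -/
theorem sum_sum_update {p : ℕ} (f : (Fin p → Fin 3) → ℂ) (i : Fin p) :
    ∑ a, ∑ b, f (Function.update a i b) = 3 * ∑ a, f a := by
  -- exchange the summation variable with the index it replaces
  have hinv : Function.Involutive
      (fun x : (Fin p → Fin 3) × Fin 3 => (Function.update x.1 i x.2, x.1 i)) := fun x => by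
    simp
  have h := Equiv.sum_comp (hinv.toPerm _) (fun x : (Fin p → Fin 3) × Fin 3 => f x.1)
  simp only [Fintype.sum_prod_type, Function.Involutive.coe_toPerm] at h
  rw [h]
  simp [Finset.mul_sum]

/-- The spinor `t_{bc} α^b_{AB} α^c_{CD}`. -/
noncomputable def pairSpinor (t : Fin 3 → Fin 3 → ℂ) (A B C D : Fin 2) : ℂ :=
  ∑ b, ∑ c, t b c * (vdW b A B * vdW c C D)

theorem pairSpinor_swap_left (t : Fin 3 → Fin 3 → ℂ) (A B C D : Fin 2) :
    pairSpinor t A B C D = pairSpinor t B A C D := by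
  simp only [pairSpinor, vdW_symm _ A B]

theorem pairSpinor_swap_right (t : Fin 3 → Fin 3 → ℂ) (A B C D : Fin 2) :
    pairSpinor t A B C D = pairSpinor t A B D C := by
  simp only [pairSpinor, vdW_symm _ C D]

/-- The spinor of a symmetric trace free tensor is symmetric across its two index pairs. -/
theorem pairSpinor_swap_mid {t : Fin 3 → Fin 3 → ℂ} (hs : ∀ b c, t b c = t c b)
    (ht : ∑ b, t b b = 0) (A B C D : Fin 2) :
    pairSpinor t A B C D = pairSpinor t A C B D := by
  -- the antisymmetric part in the middle indices is proportional to the trace of `t`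
  have key : ∀ A D, pairSpinor t A 0 1 D = pairSpinor t A 1 0 D := by
    intro A D
    have h01 := hs 0 1
    have h02 := hs 0 2
    have h12 := hs 1 2
    have hI := Complex.I_mul_I
    rw [Fin.sum_univ_three] at ht
    set κ : ℂ := ((1 / Real.sqrt 2 : ℝ) : ℂ) with hκ
    fin_cases A <;> fin_cases D <;>
      simp [pairSpinor, vdW, ← hκ, Fin.sum_univ_three, -one_div, -Complex.ofReal_div]
    · linear_combination κ * κ * (-h02 + Complex.I * h12)
    · linear_combination κ * κ * (-ht + t 1 1 * hI - Complex.I * h01)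
    · linear_combination κ * κ * (ht - t 1 1 * hI - Complex.I * h01)
    · linear_combination κ * κ * (-h02 - Complex.I * h12)
  match B, C with
  | 0, 0 => rfl
  | 1, 1 => rfl
  | 0, 1 => exact key A D
  | 1, 0 => exact (key A D).symm

theorem isTotallySymmetric_of_swap {p : ℕ} {ξ : Spinor p}
    (h : ∀ x y, x ≠ y → ∀ A, ξ (A ∘ Equiv.swap x y) = ξ A) : IsTotallySymmetric ξ := by
  intro π
  induction π using Equiv.Perm.swap_induction_on with
  | one => exact fun A => rfl
  | swap_mul f x y hxy ih =>
    intro A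
    have : A ∘ ⇑(Equiv.swap x y * f) = (A ∘ Equiv.swap x y) ∘ f := rfl
    rw [this, ih, h x y hxy]

theorem symmetrize_eq_self {p : ℕ} {ξ : Spinor p} (h : IsTotallySymmetric ξ) :
    symmetrize ξ = ξ := by
  funext A
  simp only [symmetrize, h _ A, Finset.sum_const, Finset.card_univ, Fintype.card_perm,
    Fintype.card_prod, Fintype.card_fin, nsmul_eq_mul]
  rw [mul_comm p 2, ← mul_assoc, inv_mul_cancel₀, one_mul]
  exact_mod_cast Nat.factorial_ne_zero _

/-- A tensor whose components depend only on the multi-index of its indices, and all of whose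
traces vanish, has a totally symmetric spinor. -/
theorem isTotallySymmetric_toSpinor {p : ℕ} {T : Tens p} {P : (Fin 3 →₀ ℕ) → ℂ}
    (hT : ∀ a, T a = P (∑ j, Finsupp.single (a j) 1))
    (htr : ∀ r : Fin 3 →₀ ℕ, r.degree + 2 = p →
      ∑ b, P (r + Finsupp.single b 1 + Finsupp.single b 1) = 0) :
    IsTotallySymmetric (toSpinor T) := by
  refine isTotallySymmetric_of_swap fun x y hxy A => ?_
  obtain ⟨i, u⟩ := x
  obtain ⟨j, v⟩ := y
  by_cases hij : i = j
  · subst hij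
    refine Finset.sum_congr rfl fun a _ => congrArg _ (Finset.prod_congr rfl fun l _ => ?_)
    by_cases hl : l = i
    · subst hl
      have huv : u ≠ v := fun h => hxy (by rw [h])
      have : ∀ w, Equiv.swap (l, u) (l, v) (l, w) = (l, 1 - w) := by
        clear hxy
        have hv : v = 1 - u := by
          revert u v
          decide
        intro w
        by_cases hw : w = u
        · rw [hw, Equiv.swap_apply_left, hv]
        · have hw' : w = v ∧ u = 1 - w := by
            clear hv
            revert u v w
            decide
          rw [hw'.1, Equiv.swap_apply_right, ← hw'.1, ← hw'.2]
      simp only [Function.comp_apply, this]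
      rw [vdW_symm]
      rfl
    · have : ∀ w, Equiv.swap (i, u) (i, v) (l, w) = (l, w) := fun w =>
        Equiv.swap_apply_of_ne_of_ne (fun h => hl (Prod.ext_iff.1 h).1)
          (fun h => hl (Prod.ext_iff.1 h).1)
      simp only [Function.comp_apply, this]
  · set B := A ∘ Equiv.swap (i, u) (j, v) with hB
    set f : (Fin p × Fin 2 → Fin 2) → (Fin p → Fin 3) → ℂ :=
      fun A a => T a * ∏ l, vdW (a l) (A (l, 0)) (A (l, 1)) with hf
    -- average over the indices `i` and `j`; for fixed values of the other indices `T` is a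
    -- symmetric trace free tensor `t` in these two
    have hsum : ∀ A, 3 * (3 * toSpinor T A)
        = ∑ a, ∑ b, ∑ c, f A (Function.update (Function.update a i b) j c) := fun A => by
      rw [sum_sum_update (fun a => ∑ c, f A (Function.update a j c)) i, sum_sum_update]
      rfl
    suffices h : ∀ a, ∑ b, ∑ c, f B (Function.update (Function.update a i b) j c)
        = ∑ b, ∑ c, f A (Function.update (Function.update a i b) j c) by
      have h1 := hsum B
      simp only [h] at h1
      rw [← hsum A] at h1
      have three : (3 : ℂ) ≠ 0 := by norm_num
      exact mul_left_cancel₀ three (mul_left_cancel₀ three h1)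
    intro a
    set s : Finset (Fin p) := (Finset.univ.erase j).erase i with hs
    set r : Fin 3 →₀ ℕ := ∑ l ∈ s, Finsupp.single (a l) 1 with hr
    set t : Fin 3 → Fin 3 → ℂ := fun b c => P (r + Finsupp.single b 1 + Finsupp.single c 1)
      with ht
    have his : i ∈ Finset.univ.erase j := Finset.mem_erase.2 ⟨hij, Finset.mem_univ i⟩
    have hcard : r.degree + 2 = p := by
      have h1 : s.card + 1 = (Finset.univ.erase j).card := Finset.card_erase_add_one his
      have h2 : (Finset.univ.erase j).card + 1 = p := by
        rw [Finset.card_erase_add_one (Finset.mem_univ j), Finset.card_univ, Fintype.card_fin]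
      have h3 : r.degree = s.card := by
        rw [hr, map_sum]
        simp
      omega
    have hupd : ∀ b c, ∀ l ∈ s, Function.update (Function.update a i b) j c l = a l := by
      intro b c l hl
      have h1 := (Finset.mem_erase.1 hl).1
      have h2 := (Finset.mem_erase.1 (Finset.mem_erase.1 hl).2).1
      rw [Function.update_of_ne h2, Function.update_of_ne h1]
    have hTt : ∀ b c, T (Function.update (Function.update a i b) j c) = t b c := by
      intro b c
      rw [hT, ← Finset.add_sum_erase _ _ (Finset.mem_univ j), ← Finset.add_sum_erase _ _ his,
        Finset.sum_congr rfl fun l hl => by rw [hupd b c l hl], Function.update_self,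
        Function.update_of_ne hij, Function.update_self, ← add_assoc,
        add_comm (Finsupp.single c 1 + _), add_comm (Finsupp.single c 1), ← add_assoc]
    have hfA : ∀ A, ∑ b, ∑ c, f A (Function.update (Function.update a i b) j c)
        = pairSpinor t (A (i, 0)) (A (i, 1)) (A (j, 0)) (A (j, 1))
          * ∏ l ∈ s, vdW (a l) (A (l, 0)) (A (l, 1)) := by
      intro A
      rw [pairSpinor, Finset.sum_mul]
      refine Finset.sum_congr rfl fun b _ => ?_
      rw [Finset.sum_mul]
      refine Finset.sum_congr rfl fun c _ => ?_
      simp only [hf]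
      rw [hTt, ← Finset.mul_prod_erase _ _ (Finset.mem_univ j), ← Finset.mul_prod_erase _ _ his,
        Finset.prod_congr rfl fun l hl => by rw [hupd b c l hl], Function.update_self,
        Function.update_of_ne hij, Function.update_self]
      ring
    rw [hfA, hfA]
    have hrest : ∏ l ∈ s, vdW (a l) (B (l, 0)) (B (l, 1))
        = ∏ l ∈ s, vdW (a l) (A (l, 0)) (A (l, 1)) := by
      refine Finset.prod_congr rfl fun l hl => ?_
      have h1 := (Finset.mem_erase.1 hl).1
      have h2 := (Finset.mem_erase.1 (Finset.mem_erase.1 hl).2).1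
      have : ∀ w, Equiv.swap (i, u) (j, v) (l, w) = (l, w) := fun w =>
        Equiv.swap_apply_of_ne_of_ne (fun h => h1 (Prod.ext_iff.1 h).1)
          (fun h => h2 (Prod.ext_iff.1 h).1)
      simp only [hB, Function.comp_apply, this]
    rw [hrest]
    congr 1
    have hts : ∀ b c, t b c = t c b := fun b c => by
      simp only [ht]
      rw [add_right_comm]
    have hsl := pairSpinor_swap_left t
    have hsr := pairSpinor_swap_right t
    have hsm := pairSpinor_swap_mid hts (htr r hcard)
    have hBi : B (i, u) = A (j, v) := by simp [hB]
    have hBj : B (j, v) = A (i, u) := by simp [hB]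
    have hBi' : ∀ w, w ≠ u → B (i, w) = A (i, w) := fun w hw => by
      rw [hB, Function.comp_apply, Equiv.swap_apply_of_ne_of_ne
        (fun h => hw (Prod.ext_iff.1 h).2) (fun h => hij (Prod.ext_iff.1 h).1)]
    have hBj' : ∀ w, w ≠ v → B (j, w) = A (j, w) := fun w hw => by
      rw [hB, Function.comp_apply, Equiv.swap_apply_of_ne_of_ne
        (fun h => hij (Prod.ext_iff.1 h).1.symm) (fun h => hw (Prod.ext_iff.1 h).2)]
    clear_value B
    match u, v with
    | 0, 0 =>
      rw [hBi, hBj, hBi' 1 (by decide), hBj' 1 (by decide)]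
      exact (hsl _ _ _ _).trans ((hsm _ _ _ _).trans (hsl _ _ _ _))
    | 0, 1 =>
      rw [hBi, hBj, hBi' 1 (by decide), hBj' 0 (by decide)]
      exact (hsr _ _ _ _).trans ((hsl _ _ _ _).trans ((hsm _ _ _ _).trans
        ((hsl _ _ _ _).trans (hsr _ _ _ _))))
    | 1, 0 =>
      rw [hBi, hBj, hBi' 0 (by decide), hBj' 1 (by decide)]
      exact hsm _ _ _ _
    | 1, 1 =>
      rw [hBi, hBj, hBi' 0 (by decide), hBj' 0 (by decide)]
      exact (hsr _ _ _ _).trans ((hsm _ _ _ _).trans (hsr _ _ _ _))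

/-- Every multi-index of degree `n` comes from `n` indices. -/
theorem exists_sum_single_eq (n : ℕ) : ∀ s : Fin 3 →₀ ℕ, s.degree = n →
    ∃ a : Fin n → Fin 3, ∑ j, Finsupp.single (a j) 1 = s := by
  induction n with
  | zero =>
    intro s hs
    exact ⟨Fin.elim0, by simpa using ((Finsupp.degree_eq_zero_iff s).1 hs).symm⟩
  | succ n ih =>
    intro s hs
    obtain ⟨b, m, rfl⟩ := exists_eq_add_single (n := s) (by rintro rfl; simp at hs)
    rw [map_add, Finsupp.degree_single] at hs
    obtain ⟨a, ha⟩ := ih m (by omega)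
    refine ⟨Fin.cons b a, ?_⟩
    rw [Fin.sum_univ_succ]
    simp [ha, add_comm]

/-! ### Complex conjugation of space spinors -/

theorem plus_toSpinor {p : ℕ} (T : Tens p) (A : Fin p × Fin 2 → Fin 2) :
    (-1) ^ p * plus (toSpinor T) A = toSpinor (fun a => starRingEnd ℂ (T a)) A := by
  have h1 : plus (toSpinor T) A = ∑ a : Fin p → Fin 3, starRingEnd ℂ (T a) *
      ∏ j, -vdW (a j) (A (j, 0)) (A (j, 1)) := by
    simp only [plus, toSpinor, map_sum, map_mul, map_prod, Finset.mul_sum]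
    rw [Finset.sum_comm]
    refine Finset.sum_congr rfl fun a _ => ?_
    simp only [← conj_vdW]
    rw [← sum_prod_spinorIndex (fun j u v => tau (A (j, 0)) u * tau (A (j, 1)) v *
      starRingEnd ℂ (vdW (a j) u v)), Finset.mul_sum]
    refine Finset.sum_congr rfl fun B _ => ?_
    rw [Finset.prod_mul_distrib, Fintype.prod_prod_type]
    simp only [Fin.prod_univ_two]
    ring
  rw [h1, toSpinor, Finset.mul_sum]
  refine Finset.sum_congr rfl fun a _ => ?_
  rw [Finset.prod_neg, Finset.card_univ, Fintype.card_fin]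
  have h2 : ((-1 : ℂ) ^ p) * (-1) ^ p = 1 := by
    rw [← mul_pow]
    norm_num
  linear_combination (starRingEnd ℂ (T a) * ∏ j, vdW (a j) (A (j, 0)) (A (j, 1))) * h2

theorem symmetrize_plus {p : ℕ} (ξ : Spinor p) : symmetrize (plus ξ) = plus (symmetrize ξ) := by
  have h1 : ∀ (π : Equiv.Perm (Fin p × Fin 2)) (A : Fin p × Fin 2 → Fin 2),
      plus ξ (A ∘ π) = ∑ B : Fin p × Fin 2 → Fin 2,
        (∏ k, tau (A k) (B k)) * starRingEnd ℂ (ξ (B ∘ π)) := fun π A => by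
    rw [plus, ← (Equiv.arrowCongr π.symm (Equiv.refl (Fin 2))).sum_comp]
    refine Finset.sum_congr rfl fun B _ => ?_
    rw [← Equiv.prod_comp π (fun k => tau (A k) (B k))]
    simp [Equiv.arrowCongr, Function.comp_def]
  funext A
  simp only [symmetrize, h1]
  simp only [plus, symmetrize, map_mul, map_sum, map_inv₀, map_natCast, Finset.mul_sum]
  rw [Finset.sum_comm]
  refine Finset.sum_congr rfl fun B _ => Finset.sum_congr rfl fun π _ => ?_
  ring

/-! ### Uniqueness of the formal solution -/

theorem iterDS_sub_mem_vanish {n : ℕ} {T T' : TensS n} (j m : ℕ)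
    (h : ∀ i, T' i - T i ∈ vanish (m + j)) (i : Fin (n + j) → Fin 3) :
    iterDS T' j i - iterDS T j i ∈ vanish m := by
  induction j generalizing m with
  | zero => exact h i
  | succ j ih =>
    exact dS_sub_mem_vanish (ih (m + 1) (fun i => vanish_of_le (by omega) (h i)) _) _ le_rfl

theorem toSpinor_sub {p : ℕ} (T T' : Tens p) : toSpinor (T' - T) = toSpinor T' - toSpinor T := by
  funext A
  simp only [toSpinor, Pi.sub_apply, sub_mul, Finset.sum_sub_distrib]

theorem symmetrize_sub {p : ℕ} (ξ ξ' : Spinor p) :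
    symmetrize (ξ' - ξ) = symmetrize ξ' - symmetrize ξ := by
  funext A
  simp only [symmetrize, Pi.sub_apply, mul_sub, Finset.sum_sub_distrib]

section Comparison

variable {μ : ℂ} {H G Q K H' G' Q' K' : MatS} {Z S Z' S' : Series}

/-- The null datum of the tensor `Q` with `2 + q` index pairs. -/
noncomputable def nullDatumS (H G Q : MatS) (q : ℕ) : Spinor (2 + q) :=
  symmetrize (toSpinor fun i => constantCoeff (iterCovS (chrS H G) (matTS Q) q i))

/-- The terms of degree `k` of the difference of two tensors `s_{ab}` have a potential which is
harmonic because `s_{ab}` is trace free.  Hence their spinor is totally symmetric, and it vanishes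
when the null data agree. -/
theorem sigma_sub_mem_vanish (s : IsFormalSolution μ H G Z S Q K)
    (s' : IsFormalSolution μ H' G' Z' S' Q' K') {k : ℕ}
    (hdata : nullDatumS H' G' Q' k = nullDatumS H G Q k)
    (hH : ∀ a b, H' a b - H a b ∈ vanish (k + 1)) (hQ : ∀ a b, Q' a b - Q a b ∈ vanish k)
    (hZ : Z' - Z ∈ vanish (k + 2)) (a b : Fin 3) : Q' a b - Q a b ∈ vanish (k + 1) := by
  obtain ⟨φ, hφ⟩ := exists_potential (T := Q' - Q)
    (fun a b => by rw [Matrix.sub_apply, Matrix.sub_apply, s.Q_symm, s'.Q_symm]) hQ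
    (curl_sub_mem_vanish s s' hH hQ hZ)
  have hφ' : ∀ c d, Q' c d - Q c d - dS c (dS d φ) ∈ vanish (k + 1) := hφ
  set hess : TensS 2 := fun i => dS (i 0) (dS (i 1) φ) with hhess
  set t : Tens (2 + k) := (fun i => constantCoeff (iterCovS (chrS H' G') (matTS Q') k i))
    - fun i => constantCoeff (iterCovS (chrS H G) (matTS Q) k i) with ht
  have htφ : ∀ i, t i = derivAtZero φ (∑ j, Finsupp.single (i j) 1) := fun i => by
    have h1 := iterCovS_sub_sub_iterDS_mem_vanish (T := matTS Q) (T' := matTS Q')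
      (chrS_sub_mem_vanish s.G_mul s'.G_mul hH) (fun i => hQ _ _) k 1 rfl i
    have h2 := iterDS_sub_mem_vanish (T := hess) (T' := matTS Q' - matTS Q) k 1
      (fun i => vanish_of_le (by omega) (hφ' (i 0) (i 1))) i
    have h3 := derivAtZero_iterDS (T := hess) (φ := φ) (fun _ => rfl) k i 0
    rw [zero_add, derivAtZero_zero] at h3
    rw [mem_vanish_one, map_sub, sub_eq_zero] at h1 h2
    rw [← h3, ← h2, ← h1, map_sub]
    rfl
  have hlap : ∑ b, dS b (dS b φ) ∈ vanish (k + 1) := by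
    have h1 := sub_mem (trace_sub_mem_vanish s s' hH hQ)
      (sum_mem fun b (_ : b ∈ Finset.univ) => hφ' b b)
    convert h1 using 1
    rw [← Finset.sum_sub_distrib]
    exact Finset.sum_congr rfl fun b _ => by ring
  have hsym : IsTotallySymmetric (toSpinor t) := by
    refine isTotallySymmetric_toSpinor htφ fun r hr => ?_
    simp only [← derivAtZero_dS]
    have h1 := derivAtZero_eq_zero hlap (s := r) (by omega)
    simpa only [Fin.sum_univ_three, derivAtZero_add] using h1
  have ht0 : t = 0 := by
    refine eq_zero_of_toSpinor_eq_zero ?_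
    rw [← symmetrize_eq_self hsym, ht, toSpinor_sub, symmetrize_sub]
    exact sub_eq_zero.2 hdata
  have hφ0 : ∀ n : Fin 3 →₀ ℕ, n.degree = 2 + k → derivAtZero φ n = 0 := fun n hn => by
    obtain ⟨i, rfl⟩ := exists_sum_single_eq (2 + k) n hn
    rw [← htφ, ht0]
    rfl
  rw [mem_vanish]
  intro n hn
  rcases Nat.lt_succ_iff_lt_or_eq.1 hn with h | h
  · exact mem_vanish.1 (hQ a b) n h
  · have h1 := mem_vanish.1 (hφ' a b) n hn
    rw [map_sub, sub_eq_zero] at h1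
    rw [h1]
    have h2 : derivAtZero (dS a (dS b φ)) n = 0 := by
      rw [derivAtZero_dS, derivAtZero_dS]
      refine hφ0 _ ?_
      rw [map_add, map_add, Finsupp.degree_single, Finsupp.degree_single, h]
      ring
    refine (mul_eq_zero.1 h2).resolve_left (Finset.prod_ne_zero_iff.2 fun c _ => ?_)
    exact_mod_cast Nat.factorial_ne_zero _

/-- The induction over the order of the expansion. -/
theorem sub_mem_vanish_of_nullDatumS_eq (s : IsFormalSolution μ H G Z S Q K)
    (s' : IsFormalSolution μ H' G' Z' S' Q' K')
    (hdata : ∀ q, nullDatumS H' G' Q' q = nullDatumS H G Q q) (k : ℕ) :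
    (∀ a b, H' a b - H a b ∈ vanish (k + 1)) ∧ (∀ a b, Q' a b - Q a b ∈ vanish k) ∧
      Z' - Z ∈ vanish (k + 2) ∧ S' - S ∈ vanish (k + 1) := by
  induction k with
  | zero =>
    refine ⟨s.sub_mem_vanish_one s', fun a b => mem_vanish_zero _,
      sub_mem s'.Z_mem_vanish_two s.Z_mem_vanish_two, ?_⟩
    rw [mem_vanish_one, map_sub, s.S_zero, s'.S_zero, sub_self]
  | succ k ih =>
    obtain ⟨hH, hQ, hZ, hS⟩ := ih
    exact ⟨metric_sub_mem_vanish s s' hH hQ, sigma_sub_mem_vanish s s' (hdata k) hH hQ hZ,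
      zeta_sub_mem_vanish s s' hH hQ hZ hS, s_sub_mem_vanish s s' hH hQ hZ⟩

/-- A frame which is parallel along the radial lines is determined by its value at the origin. -/
theorem frame_unique (s : IsFormalSolution μ H G Z S Q K)
    (s' : IsFormalSolution μ H G Z' S' Q' K') : K' = K := by
  have hE : ∀ d a, euler (K' d a - K d a)
      = -∑ b, X b * ∑ e, chrS H G d b e * (K' e a - K e a) := fun d a => by
    have h1 := s.parallel d a
    have h2 := s'.parallel d a
    simp only [mul_add, Finset.sum_add_distrib] at h1 h2
    simp only [mul_sub, Finset.sum_sub_distrib]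
    rw [euler_sub, euler, euler]
    linear_combination h2 - h1
  have h0 : ∀ d a, constantCoeff (K' d a - K d a) = 0 := fun d a => by
    rw [map_sub, s.K_zero, s'.K_zero, sub_self]
  have hk : ∀ k d a, K' d a - K d a ∈ vanish k := by
    intro k
    induction k with
    | zero => exact fun d a => mem_vanish_zero _
    | succ k ih =>
      intro d a
      refine mem_vanish_of_euler_mem (h0 d a) ?_
      rw [hE]
      exact neg_mem (sum_mem fun b _ => mul_mem_vanish (X_mem_vanish b)
        (sum_mem fun e _ => Ideal.mul_mem_left _ _ (ih e a)) (by omega))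
  ext1 d a
  exact sub_eq_zero.1 (eq_zero_of_forall_mem_vanish fun k => hk k d a)

theorem formalSolution_unique (s : IsFormalSolution μ H G Z S Q K)
    (s' : IsFormalSolution μ H' G' Z' S' Q' K')
    (hdata : ∀ q, nullDatumS H' G' Q' q = nullDatumS H G Q q) :
    H' = H ∧ G' = G ∧ Z' = Z ∧ S' = S ∧ Q' = Q ∧ K' = K := by
  have h := sub_mem_vanish_of_nullDatumS_eq s s' hdata
  have hH : H' = H := by
    ext1 a b
    exact sub_eq_zero.1 (eq_zero_of_forall_mem_vanish fun k =>
      vanish_of_le (Nat.le_succ k) ((h k).1 a b))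
  subst hH
  have hG : G' = G := by
    have h1 : H' * G = 1 := mul_eq_one_comm.1 s.G_mul
    rw [← mul_one G', ← h1, ← mul_assoc, s'.G_mul, one_mul]
  subst hG
  refine ⟨rfl, rfl, ?_, ?_, ?_, frame_unique s s'⟩
  · exact sub_eq_zero.1 (eq_zero_of_forall_mem_vanish fun k =>
      vanish_of_le (by omega) (h k).2.2.1)
  · exact sub_eq_zero.1 (eq_zero_of_forall_mem_vanish fun k =>
      vanish_of_le (Nat.le_succ k) (h k).2.2.2)
  · ext1 a b
    exact sub_eq_zero.1 (eq_zero_of_forall_mem_vanish fun k => (h k).2.1 a b)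

end Comparison

/-! ### Taylor series of smooth functions -/

theorem contDiffAt_pd {f : Coord → ℂ} {x : Coord} (hf : ContDiffAt ℝ ∞ f x) (a : Fin 3) :
    ContDiffAt ℝ ∞ (pd a f) x :=
  (hf.fderiv_right (m := ∞) (by simp)).clm_apply contDiffAt_const

theorem pd_congr {f g : Coord → ℂ} {x : Coord} (h : f =ᶠ[𝓝 x] g) (a : Fin 3) :
    pd a f =ᶠ[𝓝 x] pd a g := by
  filter_upwards [h.fderiv (𝕜 := ℝ)] with y hy
  rw [pd, hy, pd]

theorem eventually_differentiableAt {f : Coord → ℂ} {x : Coord} (hf : ContDiffAt ℝ ∞ f x) :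
    ∀ᶠ y in 𝓝 x, DifferentiableAt ℝ f y := by
  have h1 : ContDiffAt ℝ 1 f x := hf.of_le (by simp)
  filter_upwards [h1.eventually (by simp)] with y hy
  exact hy.differentiableAt (by simp)

theorem pd_comm {f : Coord → ℂ} {x : Coord} (hf : ContDiffAt ℝ ∞ f x) (a b : Fin 3) :
    pd a (pd b f) =ᶠ[𝓝 x] pd b (pd a f) := by
  have h2 : ContDiffAt ℝ 2 f x := contDiffAt_infty.1 hf 2
  filter_upwards [h2.eventually (by simp)] with y hy
  have hd : DifferentiableAt ℝ (fderiv ℝ f) y :=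
    (hy.fderiv_right (m := 1) (by norm_num)).differentiableAt (by simp)
  have key : ∀ a b,
      pd a (pd b f) y = fderiv ℝ (fderiv ℝ f) y (Pi.single a 1) (Pi.single b 1) := by
    intro a b
    have : pd b f = fun z => fderiv ℝ f z (Pi.single b 1) := rfl
    rw [pd, this, fderiv_clm_apply hd (differentiableAt_const _)]
    simp
  rw [key, key]
  exact (hy.isSymmSndFDerivAt (by simp)) _ _

theorem contDiffAt_pd_iterate {f : Coord → ℂ} {x : Coord} (hf : ContDiffAt ℝ ∞ f x) (a : Fin 3)
    (n : ℕ) : ContDiffAt ℝ ∞ ((pd a)^[n] f) x := by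
  induction n with
  | zero => exact hf
  | succ n ih =>
    rw [Function.iterate_succ_apply']
    exact contDiffAt_pd ih a

theorem pd_iterate_congr {f g : Coord → ℂ} {x : Coord} (h : f =ᶠ[𝓝 x] g) (a : Fin 3) (n : ℕ) :
    (pd a)^[n] f =ᶠ[𝓝 x] (pd a)^[n] g := by
  induction n with
  | zero => exact h
  | succ n ih =>
    rw [Function.iterate_succ_apply', Function.iterate_succ_apply']
    exact pd_congr ih a

theorem pd_iterate_comm {f : Coord → ℂ} {x : Coord} (hf : ContDiffAt ℝ ∞ f x) (a b : Fin 3)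
    (n : ℕ) : (pd a)^[n] (pd b f) =ᶠ[𝓝 x] pd b ((pd a)^[n] f) := by
  induction n with
  | zero => exact EventuallyEq.rfl
  | succ n ih =>
    rw [Function.iterate_succ_apply', Function.iterate_succ_apply']
    exact (pd_congr ih a).trans (pd_comm (contDiffAt_pd_iterate hf a n) a b)

/-- The mixed partial derivative of order `n` at the origin, in multi-index notation. -/
noncomputable def mixedPd (f : Coord → ℂ) (n : Fin 3 →₀ ℕ) : ℂ :=
  ((pd 0)^[n 0] ((pd 1)^[n 1] ((pd 2)^[n 2] f))) 0

theorem mixedPd_pd {f : Coord → ℂ} (hf : ContDiffAt ℝ ∞ f 0) (a : Fin 3) (n : Fin 3 →₀ ℕ) :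
    mixedPd (pd a f) n = mixedPd f (n + Finsupp.single a 1) := by
  have h2 := contDiffAt_pd_iterate hf 2 (n 2)
  have hv : ∀ b, (n + Finsupp.single a 1 : Fin 3 →₀ ℕ) b = n b + if a = b then 1 else 0 :=
    fun b => by rw [Finsupp.add_apply, Finsupp.single_apply]
  rw [mixedPd, mixedPd, hv, hv, hv]
  match a with
  | 0 =>
    have e1 := pd_iterate_congr (pd_iterate_comm hf 2 0 (n 2)) 1 (n 1)
    exact (pd_iterate_congr (e1.trans (pd_iterate_comm h2 1 0 (n 1))) 0 (n 0)).self_of_nhds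
  | 1 =>
    have e1 := pd_iterate_congr (pd_iterate_comm hf 2 1 (n 2)) 1 (n 1)
    exact (pd_iterate_congr e1 0 (n 0)).self_of_nhds
  | 2 => rfl

/-- The Taylor series at the origin. -/
noncomputable def taylor (f : Coord → ℂ) : Series := fun n =>
  (∏ a, ((n a).factorial : ℂ))⁻¹ * mixedPd f n

theorem prod_factorial_ne_zero (n : Fin 3 →₀ ℕ) : ∏ a, ((n a).factorial : ℂ) ≠ 0 :=
  Finset.prod_ne_zero_iff.2 fun _ _ => Nat.cast_ne_zero.2 (Nat.factorial_ne_zero _)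

theorem derivAtZero_taylor (f : Coord → ℂ) (n : Fin 3 →₀ ℕ) :
    derivAtZero (taylor f) n = mixedPd f n :=
  mul_inv_cancel_left₀ (prod_factorial_ne_zero n) _

theorem series_ext {F F' : Series} (h : ∀ n, derivAtZero F n = derivAtZero F' n) : F = F' := by
  ext n
  exact mul_left_cancel₀ (prod_factorial_ne_zero n) (h n)

theorem constantCoeff_taylor (f : Coord → ℂ) : constantCoeff (taylor f) = f 0 := by
  rw [← derivAtZero_zero, derivAtZero_taylor]
  rfl

theorem dS_taylor {f : Coord → ℂ} (hf : ContDiffAt ℝ ∞ f 0) (a : Fin 3) :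
    dS a (taylor f) = taylor (pd a f) :=
  series_ext fun n => by
    rw [derivAtZero_dS, derivAtZero_taylor, derivAtZero_taylor, mixedPd_pd hf]

theorem taylor_congr {f g : Coord → ℂ} (h : f =ᶠ[𝓝 0] g) : taylor f = taylor g :=
  series_ext fun n => by
    rw [derivAtZero_taylor, derivAtZero_taylor]
    exact (pd_iterate_congr (pd_iterate_congr (pd_iterate_congr h 2 _) 1 _) 0 _).self_of_nhds

/-- `f` is smooth at the origin, with Taylor series `F`. -/
structure HasTaylor (f : Coord → ℂ) (F : Series) : Prop where
  smooth : ContDiffAt ℝ ∞ f 0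
  taylor_eq : taylor f = F

theorem hasTaylor_of_contDiffAt {f : Coord → ℂ} (hf : ContDiffAt ℝ ∞ f 0) :
    HasTaylor f (taylor f) :=
  ⟨hf, rfl⟩

namespace HasTaylor

variable {f g : Coord → ℂ} {F F' : Series}

theorem constantCoeff_eq (h : HasTaylor f F) : constantCoeff F = f 0 := by
  rw [← h.taylor_eq, constantCoeff_taylor]

theorem congr (h : HasTaylor f F) (hg : f =ᶠ[𝓝 0] g) : HasTaylor g F :=
  ⟨h.smooth.congr_of_eventuallyEq hg.symm, by rw [← h.taylor_eq, taylor_congr hg]⟩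

theorem unique (h : HasTaylor f F) (h' : HasTaylor f F') : F = F' := by
  rw [← h.taylor_eq, h'.taylor_eq]

theorem pd (h : HasTaylor f F) (a : Fin 3) : HasTaylor (pd a f) (dS a F) :=
  ⟨contDiffAt_pd h.smooth a, by rw [← h.taylor_eq, dS_taylor h.smooth]⟩

theorem zero : HasTaylor (fun _ => 0) 0 := by
  refine ⟨contDiffAt_const, series_ext fun n => ?_⟩
  have h : ∀ a, StaticNull.pd a (fun _ => 0) = fun _ => 0 := fun a => by
    funext x
    simp [StaticNull.pd]
  rw [derivAtZero_taylor, mixedPd]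
  simp only [Function.iterate_fixed (h _), derivAtZero, map_zero, mul_zero]

theorem const (z : ℂ) : HasTaylor (fun _ => z) (C z) := by
  refine ⟨contDiffAt_const, pderiv.ext (fun a => ?_) ?_⟩
  · have h : StaticNull.pd a (fun _ => z) = fun _ => 0 := by
      funext x
      simp [StaticNull.pd]
    rw [dS_taylor contDiffAt_const, h, zero.taylor_eq, pderiv_C]
  · rw [constantCoeff_taylor, constantCoeff_C]

/-- The sum rule holds order by order, since differentiating it gives the sum rule for the
derivatives. -/
theorem add (hf : HasTaylor f F) (hg : HasTaylor g F') :
    HasTaylor (fun x => f x + g x) (F + F') := by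
  have key : ∀ k, ∀ f g, ContDiffAt ℝ ∞ f 0 → ContDiffAt ℝ ∞ g 0 →
      taylor (fun x => f x + g x) - (taylor f + taylor g) ∈ vanish k := by
    intro k
    induction k with
    | zero => exact fun f g _ _ => mem_vanish_zero _
    | succ k ih =>
      intro f g hf hg
      refine mem_vanish_succ (by simp only [map_sub, map_add, constantCoeff_taylor, sub_self])
        fun a => ?_
      have e : StaticNull.pd a (fun x => f x + g x)
          =ᶠ[𝓝 0] fun x => StaticNull.pd a f x + StaticNull.pd a g x := by
        filter_upwards [eventually_differentiableAt hf, eventually_differentiableAt hg]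
          with y h1 h2
        simp only [StaticNull.pd]
        rw [fderiv_fun_add h1 h2]
        rfl
      rw [map_sub, map_add, dS_taylor hf, dS_taylor hg, dS_taylor (hf.add hg), taylor_congr e]
      exact ih _ _ (contDiffAt_pd hf a) (contDiffAt_pd hg a)
  refine ⟨hf.smooth.add hg.smooth, ?_⟩
  rw [← hf.taylor_eq, ← hg.taylor_eq]
  exact sub_eq_zero.1 (eq_zero_of_forall_mem_vanish fun k => key k f g hf.smooth hg.smooth)

/-- The product rule holds order by order, since differentiating it gives a sum of product rules
with one factor differentiated. -/
theorem mul (hf : HasTaylor f F) (hg : HasTaylor g F') :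
    HasTaylor (fun x => f x * g x) (F * F') := by
  have key : ∀ k, ∀ f g, ContDiffAt ℝ ∞ f 0 → ContDiffAt ℝ ∞ g 0 →
      taylor (fun x => f x * g x) - taylor f * taylor g ∈ vanish k := by
    intro k
    induction k with
    | zero => exact fun f g _ _ => mem_vanish_zero _
    | succ k ih =>
      intro f g hf hg
      refine mem_vanish_succ (by simp only [map_sub, map_mul, constantCoeff_taylor, sub_self])
        fun a => ?_
      have e : StaticNull.pd a (fun x => f x * g x)
          =ᶠ[𝓝 0] fun x => StaticNull.pd a f x * g x + f x * StaticNull.pd a g x := by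
        filter_upwards [eventually_differentiableAt hf, eventually_differentiableAt hg]
          with y h1 h2
        simp only [StaticNull.pd]
        rw [fderiv_fun_mul h1 h2]
        simp only [add_apply, smul_apply, smul_eq_mul]
        ring
      have hf' := contDiffAt_pd hf a
      have hg' := contDiffAt_pd hg a
      rw [map_sub, dS_mul, dS_taylor hf, dS_taylor hg, dS_taylor (hf.mul hg), taylor_congr e,
        (add (f := fun x => StaticNull.pd a f x * g x) (g := fun x => f x * StaticNull.pd a g x)
          (hasTaylor_of_contDiffAt (hf'.mul hg)) (hasTaylor_of_contDiffAt (hf.mul hg'))).taylor_eq]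
      exact sub_add_mem_vanish (ih _ _ hf' hg) (ih _ _ hf hg')
  refine ⟨hf.smooth.mul hg.smooth, ?_⟩
  rw [← hf.taylor_eq, ← hg.taylor_eq]
  exact sub_eq_zero.1 (eq_zero_of_forall_mem_vanish fun k => key k f g hf.smooth hg.smooth)

theorem neg (hf : HasTaylor f F) : HasTaylor (fun x => -f x) (-F) := by
  have h := (const (-1)).mul hf
  simpa only [map_neg, map_one, neg_mul, one_mul] using h

theorem sub (hf : HasTaylor f F) (hg : HasTaylor g F') :
    HasTaylor (fun x => f x - g x) (F - F') := by
  simpa only [sub_eq_add_neg] using hf.add hg.neg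

theorem sum {ι : Type*} {s : Finset ι} {f : ι → Coord → ℂ} {F : ι → Series}
    (h : ∀ i, HasTaylor (f i) (F i)) : HasTaylor (fun x => ∑ i ∈ s, f i x) (∑ i ∈ s, F i) := by
  classical
  induction s using Finset.induction_on with
  | empty => simpa using zero
  | insert i s hi ih =>
    simp only [Finset.sum_insert hi]
    exact (h i).add ih

theorem coord (b : Fin 3) : HasTaylor (fun x => (x b : ℂ)) (X b) := by
  have hs : ContDiff ℝ ∞ (fun x : Coord => (x b : ℂ)) :=
    Complex.ofRealCLM.contDiff.comp (contDiff_apply ℝ ℝ b)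
  refine ⟨hs.contDiffAt, pderiv.ext (fun a => ?_) ?_⟩
  · have h : StaticNull.pd a (fun x => (x b : ℂ)) = fun _ => if a = b then 1 else 0 := by
      funext x
      have h1 : HasFDerivAt (fun x : Coord => (x b : ℂ))
          (Complex.ofRealCLM.comp (ContinuousLinearMap.proj (φ := fun _ : Fin 3 => ℝ) b)) x :=
        (Complex.ofRealCLM.comp
          (ContinuousLinearMap.proj (φ := fun _ : Fin 3 => ℝ) b)).hasFDerivAt
      rw [StaticNull.pd, h1.fderiv]
      by_cases hab : a = b
      · subst hab
        simp
      · simp [hab]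
    rw [dS_taylor hs.contDiffAt, h, (const _).taylor_eq, dS_X]
    split_ifs <;> simp
  · rw [constantCoeff_taylor]
    simp

theorem eq_zero_of_eventuallyEq (h : HasTaylor f F) (h0 : f =ᶠ[𝓝 0] fun _ => 0) : F = 0 :=
  (h.congr h0).unique zero

end HasTaylor

/-- On the coordinate basis the iterated Fréchet derivative at the origin is given by the Taylor
series. -/
theorem iteratedFDeriv_single {p : ℕ} : ∀ {f : Coord → ℂ}, ContDiffAt ℝ ∞ f 0 →
    ∀ i : Fin p → Fin 3, iteratedFDeriv ℝ p f 0 (fun j => Pi.single (i j) 1)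
      = derivAtZero (taylor f) (∑ j, Finsupp.single (i j) 1) := by
  induction p with
  | zero =>
    intro f hf i
    simp [derivAtZero_zero, constantCoeff_taylor]
  | succ p ih =>
    intro f hf i
    have hd : ContDiffAt ℝ ∞ (fderiv ℝ f) 0 := hf.fderiv_right (m := ∞) (by simp)
    rw [iteratedFDeriv_succ_apply_right]
    have h1 := (ContinuousLinearMap.apply ℝ ℂ
      (Pi.single (i (Fin.last p)) 1 : Coord)).iteratedFDeriv_comp_left hd (i := p)
        (by exact_mod_cast le_top)
    have h2 := ih (contDiffAt_pd hf (i (Fin.last p))) (fun j => i j.castSucc)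
    have h3 : (ContinuousLinearMap.apply ℝ ℂ (Pi.single (i (Fin.last p)) 1 : Coord))
        ∘ fderiv ℝ f = pd (i (Fin.last p)) f := rfl
    rw [h3] at h1
    rw [h1, ← dS_taylor hf, derivAtZero_dS] at h2
    rw [Fin.sum_univ_castSucc, ← h2]
    rfl

theorem iteratedFDeriv_eq_of_taylor_eq {f g : Coord → ℂ} (hf : ContDiffAt ℝ ∞ f 0)
    (hg : ContDiffAt ℝ ∞ g 0) (h : taylor f = taylor g) (p : ℕ) :
    iteratedFDeriv ℝ p f 0 = iteratedFDeriv ℝ p g 0 := by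
  apply ContinuousMultilinearMap.toMultilinearMap_injective
  refine Module.Basis.ext_multilinear (fun _ => Pi.basisFun ℝ (Fin 3)) fun i => ?_
  simp only [Pi.basisFun_apply]
  exact (iteratedFDeriv_single hf i).trans (h ▸ (iteratedFDeriv_single hg i).symm)

/-! ### From solutions to formal solutions -/

theorem HasTaylor.div_two {f : Coord → ℂ} {F : Series} (h : HasTaylor f F) :
    HasTaylor (fun x => f x / 2) (C (1 / 2) * F) := by
  refine ((HasTaylor.const (1 / 2)).mul h).congr (Eventually.of_forall fun x => ?_)
  show 1 / 2 * f x = f x / 2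
  ring

theorem hasTaylor_covD {h : MatField} {Γ : Fin 3 → Fin 3 → Fin 3 → Series}
    (hΓ : ∀ a b c, HasTaylor (christoffel h a b c) (Γ a b c)) {n : ℕ} {T : Coord → Tens n}
    {F : TensS n} (hT : ∀ i, HasTaylor (fun x => T x i) (F i)) (i : Fin (n + 1) → Fin 3) :
    HasTaylor (fun x => covD h T x i) (covS Γ F i) :=
  ((hT _).pd _).sub (HasTaylor.sum fun _ => HasTaylor.sum fun _ => (hΓ _ _ _).mul (hT _))

theorem hasTaylor_iterCovD {h : MatField} {Γ : Fin 3 → Fin 3 → Fin 3 → Series}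
    (hΓ : ∀ a b c, HasTaylor (christoffel h a b c) (Γ a b c)) {n : ℕ} {T : Coord → Tens n}
    {F : TensS n} (hT : ∀ i, HasTaylor (fun x => T x i) (F i)) (p : ℕ) :
    ∀ i, HasTaylor (fun x => iterCovD h T p x i) (iterCovS Γ F p i) := by
  induction p with
  | zero => exact hT
  | succ p ih => exact hasTaylor_covD hΓ ih

/-- The Taylor series of the entries of a field of matrices. -/
noncomputable def taylorMat (M : MatField) : MatS := Matrix.of fun a b => taylor fun x => M x a b

theorem hasTaylor_christoffel {h : MatField} (hh : ∀ a b, ContDiffAt ℝ ∞ (fun x => h x a b) 0)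
    (hg : ∀ a b, ContDiffAt ℝ ∞ (fun x => (h x)⁻¹ a b) 0) (a b c : Fin 3) :
    HasTaylor (christoffel h a b c) (chrS (taylorMat h) (taylorMat fun x => (h x)⁻¹) a b c) :=
  (HasTaylor.const (1 / 2)).mul (HasTaylor.sum fun d => (hasTaylor_of_contDiffAt (hg a d)).mul
    ((((hasTaylor_of_contDiffAt (hh d c)).pd b).add ((hasTaylor_of_contDiffAt (hh d b)).pd c)).sub
      ((hasTaylor_of_contDiffAt (hh b c)).pd d)))

variable {m : ℝ} {U : Set Coord} {h c σ : MatField} {ζ s : Coord → ℂ}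

/-- The inverse metric is a polynomial in the components of an orthonormal frame. -/
theorem IsNormalFrame.inverse_eq (hc : IsNormalFrame U h c) {x : Coord} (hx : x ∈ U) :
    (h x)⁻¹ = -(c x * (c x)ᵀ) := by
  refine Matrix.inv_eq_left_inv ?_
  have h1 : (-((c x)ᵀ * h x)) * c x = 1 := by
    rw [neg_mul, hc.orthonormal x hx, neg_neg]
  have h2 := mul_eq_one_comm.1 h1
  rw [← h2]
  simp only [mul_neg, neg_mul, Matrix.mul_assoc]

theorem IsNormalFrame.contDiffAt_inverse (hU : IsOpen U) (hU0 : (0 : Coord) ∈ U)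
    (hc : IsNormalFrame U h c) (a b : Fin 3) : ContDiffAt ℝ ∞ (fun x => (h x)⁻¹ a b) 0 := by
  have hcs : ∀ a b, ContDiffAt ℝ ∞ (fun x => c x a b) 0 := fun a b =>
    (hc.smooth a b).contDiffAt (hU.mem_nhds hU0)
  have h1 : ContDiffAt ℝ ∞ (fun x => -∑ d, c x a d * c x b d) 0 :=
    (ContDiffAt.sum fun d _ => (hcs a d).mul (hcs b d)).neg
  refine h1.congr_of_eventuallyEq ?_
  filter_upwards [hU.mem_nhds hU0] with x hx
  rw [hc.inverse_eq hx]
  rfl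

theorem IsNormalFrame.metric_zero (hU0 : (0 : Coord) ∈ U) (hc : IsNormalFrame U h c) :
    h 0 = -1 := by
  have := hc.orthonormal 0 hU0
  rwa [hc.at_zero, Matrix.transpose_one, one_mul, mul_one] at this

/-- The value of `s` at `i` is fixed by `D_a D_b ζ = -2 h_{ab}` and the equation for `D_a D_b ζ`. -/
theorem IsConformalStaticVacuum.s_zero (hU0 : (0 : Coord) ∈ U)
    (hsol : IsConformalStaticVacuum m U h ζ s σ) (hc : IsNormalFrame U h c) : s 0 = -2 := by
  have h1 := hsol.hess_eq 0 hU0 0 0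
  rw [hsol.ddzeta_zero, hsol.zeta_zero, hc.metric_zero hU0] at h1
  simp only [Matrix.neg_apply, Matrix.one_apply_eq] at h1
  linear_combination h1

/-- The Taylor series at `i` of a solution in normal coordinates. -/
theorem isFormalSolution (hU : IsOpen U) (hU0 : (0 : Coord) ∈ U)
    (hsol : IsConformalStaticVacuum m U h ζ s σ) (hc : IsNormalFrame U h c) :
    IsFormalSolution ((m : ℂ) ^ 2 / 4) (taylorMat h) (taylorMat fun x => (h x)⁻¹) (taylor ζ)
      (taylor s) (taylorMat σ) (taylorMat c) := by
  have hN := hU.mem_nhds hU0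
  have zero_of : ∀ {f : Coord → ℂ} {F : Series}, HasTaylor f F → (∀ x ∈ U, f x = 0) → F = 0 :=
    fun hf h0 => hf.eq_zero_of_eventuallyEq (by filter_upwards [hN] with x hx using h0 x hx)
  have sh := fun a b => (hsol.smooth_h a b).contDiffAt hN
  have sG := hc.contDiffAt_inverse hU hU0
  have hH : ∀ a b, HasTaylor (fun x => h x a b) (taylorMat h a b) := fun a b =>
    hasTaylor_of_contDiffAt (sh a b)
  have hG : ∀ a b, HasTaylor (fun x => (h x)⁻¹ a b) (taylorMat (fun x => (h x)⁻¹) a b) :=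
    fun a b => hasTaylor_of_contDiffAt (sG a b)
  have hQ : ∀ a b, HasTaylor (fun x => σ x a b) (taylorMat σ a b) := fun a b =>
    hasTaylor_of_contDiffAt ((hsol.smooth_sigma a b).contDiffAt hN)
  have hK : ∀ a b, HasTaylor (fun x => c x a b) (taylorMat c a b) := fun a b =>
    hasTaylor_of_contDiffAt ((hc.smooth a b).contDiffAt hN)
  have hZ : HasTaylor ζ (taylor ζ) := hasTaylor_of_contDiffAt (hsol.smooth_zeta.contDiffAt hN)
  have hS : HasTaylor s (taylor s) := hasTaylor_of_contDiffAt (hsol.smooth_s.contDiffAt hN)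
  have hΓ := hasTaylor_christoffel sh sG
  have hμZ : HasTaylor (fun x => 1 - (m : ℂ) ^ 2 / 4 * ζ x)
      (1 - C ((m : ℂ) ^ 2 / 4) * taylor ζ) := by
    have := (HasTaylor.const 1).sub ((HasTaylor.const ((m : ℂ) ^ 2 / 4)).mul hZ)
    rwa [map_one] at this
  have hcovQ := hasTaylor_covD hΓ (T := matT σ) (F := matTS (taylorMat σ)) (fun i => hQ _ _)
  have hcovZ := hasTaylor_covD hΓ (hasTaylor_covD hΓ (T := scalarT ζ) (F := scalarS (taylor ζ))
    (fun i => hZ))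
  refine ⟨?_, ?_, ?_, ?_, ?_, ?_, ?_, ?_, ?_, ?_, ?_, ?_, ?_, ?_, ?_⟩
  · exact fun a b => sub_eq_zero.1 (zero_of ((hH a b).sub (hH b a))
      fun x hx => sub_eq_zero.2 (hsol.h_symm x hx a b))
  · ext1 a b
    rw [Matrix.mul_apply]
    have h1 : HasTaylor (fun x => ∑ d, (h x)⁻¹ a d * h x d b)
        (C ((1 : Matrix (Fin 3) (Fin 3) ℂ) a b)) := by
      refine (HasTaylor.const _).congr ?_
      filter_upwards [hN] with x hx
      rw [← Matrix.mul_apply, Matrix.nonsing_inv_mul _ (hsol.h_nondeg x hx).isUnit]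
    rw [(HasTaylor.sum fun d => (hG a d).mul (hH d b)).unique h1, Matrix.one_apply,
      Matrix.one_apply]
    split_ifs <;> simp
  · intro a b
    rw [(hH a b).constantCoeff_eq, hc.metric_zero hU0, Matrix.neg_apply, Matrix.one_apply]
    split_ifs <;> simp
  · exact fun a b => sub_eq_zero.1 (zero_of ((hQ a b).sub (hQ b a))
      fun x hx => sub_eq_zero.2 (hsol.sigma_symm x hx a b))
  · exact zero_of (HasTaylor.sum fun a => HasTaylor.sum fun b => (hG a b).mul (hQ a b))
      hsol.sigma_trace
  · rw [hZ.constantCoeff_eq, hsol.zeta_zero]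
  · intro a
    rw [(hZ.pd a).constantCoeff_eq, hsol.dzeta_zero]
  · rw [hS.constantCoeff_eq, hsol.s_zero hU0 hc]
  · intro a b
    refine sub_eq_zero.1 (zero_of (f := fun x => ricci h a b x - σ x a b)
      (HasTaylor.sub ?_ (hQ a b))
      fun x hx => sub_eq_zero.2 (hsol.ricci_eq x hx a b))
    exact HasTaylor.sum fun e => (((hΓ _ _ _).pd _).sub ((hΓ _ _ _).pd _)).add
      (HasTaylor.sum fun d => ((hΓ _ _ _).mul (hΓ _ _ _)).sub ((hΓ _ _ _).mul (hΓ _ _ _)))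
  · exact fun a b => zero_of (((hcovZ ![a, b]).sub (hS.mul (hH a b))).add
      ((hZ.mul hμZ).mul (hQ a b))) fun x hx => hsol.hess_eq x hx a b
  · exact fun a => zero_of ((hS.pd a).add (hμZ.mul (HasTaylor.sum fun b => (hQ a b).mul
      (HasTaylor.sum fun d => (hG b d).mul (hZ.pd d))))) fun x hx => hsol.ds_eq x hx a
  · exact fun e a b => zero_of
      ((hμZ.mul ((hcovQ ![e, a, b]).sub (hcovQ ![a, e, b])).div_two).sub
        ((HasTaylor.const ((m : ℂ) ^ 2 / 4)).mul
          ((((hZ.pd e).mul (hQ a b)).sub ((hZ.pd a).mul (hQ e b))).add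
            (HasTaylor.sum fun d => (HasTaylor.sum fun f => (hG d f).mul (hZ.pd f)).mul
              (((hQ d e).mul (hH a b)).sub ((hQ d a).mul (hH e b))).div_two))))
      fun x hx => hsol.cotton_eq x hx e a b
  · exact fun a => zero_of (HasTaylor.sum fun b => HasTaylor.sum fun d =>
      ((hΓ a b d).mul (HasTaylor.coord b)).mul (HasTaylor.coord d)) fun x hx => hc.geodesic x hx a
  · intro a b
    rw [(hK a b).constantCoeff_eq, hc.at_zero, Matrix.one_apply]
  · exact fun d a => zero_of (HasTaylor.sum fun b => (HasTaylor.coord b).mul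
      (((hK d a).pd b).add (HasTaylor.sum fun e => (hΓ d b e).mul (hK e a))))
      fun x hx => hc.parallel x hx d a

theorem frameComp_one {n : ℕ} (T : Tens n) : frameComp 1 T = T := by
  funext a
  have h1 : ∀ b : Fin n → Fin 3, (∏ j, (1 : Matrix (Fin 3) (Fin 3) ℂ) (b j) (a j)) * T b
      = if b = a then T b else 0 := fun b => by
    split_ifs with hb
    · subst hb
      simp only [Matrix.one_apply_eq, Finset.prod_const_one, one_mul]
    · obtain ⟨j, hj⟩ := Function.ne_iff.1 hb
      have h0 : (1 : Matrix (Fin 3) (Fin 3) ℂ) (b j) (a j) = 0 := Matrix.one_apply_ne hj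
      rw [Finset.prod_eq_zero (i := j) (Finset.mem_univ j) h0, zero_mul]
  simp only [frameComp, h1, Finset.sum_ite_eq', Finset.mem_univ, if_true]

/-- The coefficients of the normal expansion of a tensor field are determined by the Taylor series
of the metric and of the field. -/
theorem normalCoeff_eq (hU : IsOpen U) (hU0 : (0 : Coord) ∈ U)
    (hsol : IsConformalStaticVacuum m U h ζ s σ) (hc : IsNormalFrame U h c) {n : ℕ}
    {T : Coord → Tens n} {F : TensS n} (hT : ∀ i, HasTaylor (fun x => T x i) (F i)) (p : ℕ) :
    normalCoeff h c T p = toSpinor fun i => constantCoeff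
      (iterCovS (chrS (taylorMat h) (taylorMat fun x => (h x)⁻¹)) F p i) := by
  have hΓ := hasTaylor_christoffel (fun a b => (hsol.smooth_h a b).contDiffAt (hU.mem_nhds hU0))
    (hc.contDiffAt_inverse hU hU0)
  rw [normalCoeff, hc.at_zero, frameComp_one]
  congr 1
  funext i
  rw [(hasTaylor_iterCovD hΓ hT p i).constantCoeff_eq]

/-! ### Uniqueness of the expansion coefficients -/

section Unique

variable {m : ℝ} {U U' : Set Coord} {h c σ h' c' σ' : MatField} {ζ s ζ' s' : Coord → ℂ}

theorem nullDatum_eq (hU : IsOpen U) (hU0 : (0 : Coord) ∈ U)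
    (hsol : IsConformalStaticVacuum m U h ζ s σ) (hc : IsNormalFrame U h c) (q : ℕ) :
    nullDatum h c σ q
      = nullDatumS (taylorMat h) (taylorMat fun x => (h x)⁻¹) (taylorMat σ) q := by
  rw [nullDatum, nullDatumS, normalCoeff_eq hU hU0 hsol hc (F := matTS (taylorMat σ))]
  exact fun i => hasTaylor_of_contDiffAt ((hsol.smooth_sigma _ _).contDiffAt (hU.mem_nhds hU0))

/-- Two solutions in normal coordinates with the same null data have the same expansions. -/
theorem expansion_unique (hU : IsOpen U) (hU0 : (0 : Coord) ∈ U)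
    (hsol : IsConformalStaticVacuum m U h ζ s σ) (hc : IsNormalFrame U h c)
    (hU' : IsOpen U') (hU0' : (0 : Coord) ∈ U')
    (hsol' : IsConformalStaticVacuum m U' h' ζ' s' σ') (hc' : IsNormalFrame U' h' c')
    (hdata : ∀ q, nullDatum h' c' σ' q = nullDatum h c σ q) :
    (∀ p,
      normalCoeff h' c' (matT h') p = normalCoeff h c (matT h) p ∧
      normalCoeff h' c' (scalarT ζ') p = normalCoeff h c (scalarT ζ) p ∧
      normalCoeff h' c' (scalarT s') p = normalCoeff h c (scalarT s) p ∧
      normalCoeff h' c' (matT σ') p = normalCoeff h c (matT σ) p) ∧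
    (∀ (p : ℕ) (a b : Fin 3),
      iteratedFDeriv ℝ p (fun x => h' x a b) 0 = iteratedFDeriv ℝ p (fun x => h x a b) 0 ∧
      iteratedFDeriv ℝ p (fun x => c' x a b) 0 = iteratedFDeriv ℝ p (fun x => c x a b) 0) := by
  have hN := hU.mem_nhds hU0
  have hN' := hU'.mem_nhds hU0'
  obtain ⟨eH, eG, eZ, eS, eQ, eK⟩ := formalSolution_unique
    (isFormalSolution hU hU0 hsol hc) (isFormalSolution hU' hU0' hsol' hc') fun q => by
      rw [← nullDatum_eq hU hU0 hsol hc, ← nullDatum_eq hU' hU0' hsol' hc', hdata]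
  have coeff_eq : ∀ {n : ℕ} {T T' : Coord → Tens n} {F F' : TensS n},
      (∀ i, HasTaylor (fun x => T x i) (F i)) → (∀ i, HasTaylor (fun x => T' x i) (F' i)) →
      F' = F → ∀ p, normalCoeff h' c' T' p = normalCoeff h c T p := by
    intro n T T' F F' hT hT' hF p
    rw [normalCoeff_eq hU hU0 hsol hc hT, normalCoeff_eq hU' hU0' hsol' hc' hT', eH, eG, hF]
  refine ⟨fun p => ⟨?_, ?_, ?_, ?_⟩, fun p a b => ⟨?_, ?_⟩⟩
  · exact coeff_eq (F := matTS (taylorMat h)) (F' := matTS (taylorMat h'))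
      (fun i => hasTaylor_of_contDiffAt ((hsol.smooth_h _ _).contDiffAt hN))
      (fun i => hasTaylor_of_contDiffAt ((hsol'.smooth_h _ _).contDiffAt hN')) (by rw [eH]) p
  · exact coeff_eq (F := scalarS (taylor ζ)) (F' := scalarS (taylor ζ'))
      (fun i => hasTaylor_of_contDiffAt (hsol.smooth_zeta.contDiffAt hN))
      (fun i => hasTaylor_of_contDiffAt (hsol'.smooth_zeta.contDiffAt hN')) (by rw [eZ]) p
  · exact coeff_eq (F := scalarS (taylor s)) (F' := scalarS (taylor s'))
      (fun i => hasTaylor_of_contDiffAt (hsol.smooth_s.contDiffAt hN))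
      (fun i => hasTaylor_of_contDiffAt (hsol'.smooth_s.contDiffAt hN')) (by rw [eS]) p
  · exact coeff_eq (F := matTS (taylorMat σ)) (F' := matTS (taylorMat σ'))
      (fun i => hasTaylor_of_contDiffAt ((hsol.smooth_sigma _ _).contDiffAt hN))
      (fun i => hasTaylor_of_contDiffAt ((hsol'.smooth_sigma _ _).contDiffAt hN')) (by rw [eQ]) p
  · exact iteratedFDeriv_eq_of_taylor_eq ((hsol'.smooth_h a b).contDiffAt hN')
      ((hsol.smooth_h a b).contDiffAt hN) (congrFun (congrFun eH a) b) p
  · exact iteratedFDeriv_eq_of_taylor_eq ((hc'.smooth a b).contDiffAt hN')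
      ((hc.smooth a b).contDiffAt hN) (congrFun (congrFun eK a) b) p

end Unique

/-! ### The complex conjugate of a solution -/

/-- The complex conjugate of a function. -/
noncomputable def conjF (f : Coord → ℂ) : Coord → ℂ := fun x => starRingEnd ℂ (f x)

/-- The complex conjugate of a field of matrices. -/
noncomputable def conjM (M : MatField) : MatField := fun x => (M x).map (starRingEnd ℂ)

/-- The complex conjugate of a tensor field. -/
noncomputable def conjT {n : ℕ} (T : Coord → Tens n) : Coord → Tens n :=
  fun x i => starRingEnd ℂ (T x i)

theorem pd_conj (a : Fin 3) (f : Coord → ℂ) (x : Coord) :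
    pd a (fun y => starRingEnd ℂ (f y)) x = starRingEnd ℂ (pd a f x) := by
  have h1 : (fun y => starRingEnd ℂ (f y)) = Complex.conjCLE ∘ f := rfl
  rw [pd, h1, ContinuousLinearEquiv.comp_fderiv]
  rfl

theorem conjM_inv (M : MatField) (x : Coord) (a b : Fin 3) :
    (conjM M x)⁻¹ a b = starRingEnd ℂ ((M x)⁻¹ a b) := by
  have h1 : conjM M x = ((M x)ᴴ)ᵀ := rfl
  rw [h1, ← Matrix.transpose_nonsing_inv, ← Matrix.conjTranspose_nonsing_inv]
  rfl

theorem christoffel_conj (h : MatField) (a b c : Fin 3) (x : Coord) :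
    christoffel (conjM h) a b c x = starRingEnd ℂ (christoffel h a b c x) := by
  have hm : ∀ x a b, conjM h x a b = starRingEnd ℂ (h x a b) := fun _ _ _ => rfl
  simp only [christoffel, conjM_inv, hm, pd_conj, map_mul, map_sum, map_add, map_sub, map_div₀,
    map_one, map_ofNat]

theorem covD_conj (h : MatField) {n : ℕ} (T : Coord → Tens n) :
    covD (conjM h) (conjT T) = conjT (covD h T) := by
  funext x i
  simp only [covD, conjT, christoffel_conj, pd_conj, map_sub, map_sum, map_mul]

theorem iterCovD_conj (h : MatField) {n : ℕ} (T : Coord → Tens n) (p : ℕ) :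
    iterCovD (conjM h) (conjT T) p = conjT (iterCovD h T p) := by
  induction p with
  | zero => rfl
  | succ p ih =>
    rw [iterCovD, ih, covD_conj]
    rfl

theorem ricci_conj (h : MatField) (a b : Fin 3) (x : Coord) :
    ricci (conjM h) a b x = starRingEnd ℂ (ricci h a b x) := by
  have hΓ : ∀ a b c, christoffel (conjM h) a b c
      = fun x => starRingEnd ℂ (christoffel h a b c x) := fun a b c =>
    funext fun x => christoffel_conj h a b c x
  simp only [ricci, hΓ, pd_conj, map_sum, map_add, map_sub, map_mul]

theorem contDiffOn_conj {f : Coord → ℂ} {U : Set Coord} (hf : ContDiffOn ℝ ∞ f U) :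
    ContDiffOn ℝ ∞ (fun x => starRingEnd ℂ (f x)) U :=
  Complex.conjCLE.contDiff.comp_contDiffOn hf

theorem conj_iteratedFDeriv (f : Coord → ℂ) (p : ℕ) (v : Fin p → Coord) :
    iteratedFDeriv ℝ p (fun x => starRingEnd ℂ (f x)) 0 v
      = starRingEnd ℂ (iteratedFDeriv ℝ p f 0 v) := by
  have h1 : (fun y => starRingEnd ℂ (f y)) = Complex.conjCLE ∘ f := rfl
  rw [h1, ContinuousLinearEquiv.iteratedFDeriv_comp_left]
  rfl

section Conj

variable {m : ℝ} {U : Set Coord} {h c σ : MatField} {ζ s : Coord → ℂ}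

theorem IsConformalStaticVacuum.conj (hsol : IsConformalStaticVacuum m U h ζ s σ) :
    IsConformalStaticVacuum m U (conjM h) (conjF ζ) (conjF s) (conjM σ) := by
  have hh : ∀ x a b, conjM h x a b = starRingEnd ℂ (h x a b) := fun _ _ _ => rfl
  have hσ : ∀ x a b, conjM σ x a b = starRingEnd ℂ (σ x a b) := fun _ _ _ => rfl
  have hζ : ∀ x, conjF ζ x = starRingEnd ℂ (ζ x) := fun _ => rfl
  have hs : ∀ x, conjF s x = starRingEnd ℂ (s x) := fun _ => rfl
  have hpζ : ∀ a x, pd a (conjF ζ) x = starRingEnd ℂ (pd a ζ x) := fun a x => pd_conj a ζ x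
  have hps : ∀ a x, pd a (conjF s) x = starRingEnd ℂ (pd a s x) := fun a x => pd_conj a s x
  have hcovζ : ∀ x i, covD (conjM h) (covD (conjM h) (scalarT (conjF ζ))) x i
      = starRingEnd ℂ (covD h (covD h (scalarT ζ)) x i) := fun x i => by
    have h1 : scalarT (conjF ζ) = conjT (scalarT ζ) := rfl
    rw [h1, covD_conj, covD_conj]
    rfl
  have hcovσ : ∀ x i, covD (conjM h) (matT (conjM σ)) x i
      = starRingEnd ℂ (covD h (matT σ) x i) := fun x i => by
    have h1 : matT (conjM σ) = conjT (matT σ) := rfl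
    rw [h1, covD_conj]
    rfl
  have key := fun {z : ℂ} (hz : z = 0) => (congrArg (starRingEnd ℂ) hz).trans (map_zero _)
  refine ⟨fun a b => contDiffOn_conj (hsol.smooth_h a b), contDiffOn_conj hsol.smooth_zeta,
    contDiffOn_conj hsol.smooth_s, fun a b => contDiffOn_conj (hsol.smooth_sigma a b),
    fun x hx a b => congrArg (starRingEnd ℂ) (hsol.h_symm x hx a b), fun x hx => ?_,
    fun x hx a b => congrArg (starRingEnd ℂ) (hsol.sigma_symm x hx a b), fun x hx => ?_,
    key hsol.zeta_zero, fun a => (hpζ a 0).trans (key (hsol.dzeta_zero a)), fun a b => ?_,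
    fun x hx a b => ?_, fun x hx a b => ?_, fun x hx a => ?_, fun x hx e a b => ?_⟩
  · have h1 : (conjM h x).det = starRingEnd ℂ (h x).det := ((starRingEnd ℂ).map_det (h x)).symm
    rw [h1]
    exact (map_ne_zero _).2 (hsol.h_nondeg x hx)
  · simpa only [conjM_inv, hσ, map_sum, map_mul] using key (hsol.sigma_trace x hx)
  · rw [hcovζ, hsol.ddzeta_zero, hh, map_mul, map_neg, map_ofNat]
  · rw [ricci_conj, hsol.ricci_eq x hx]
    rfl
  · have h1 := key (hsol.hess_eq x hx a b)
    simpa only [hcovζ, hh, hσ, hζ, hs, map_add, map_sub, map_mul, map_one, map_div₀, map_pow,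
      map_ofNat, Complex.conj_ofReal] using h1
  · have h1 := key (hsol.ds_eq x hx a)
    simpa only [hps, hpζ, conjM_inv, hσ, hζ, map_add, map_sub, map_mul, map_sum, map_one, map_div₀,
      map_pow, map_ofNat, Complex.conj_ofReal] using h1
  · have h1 := key (hsol.cotton_eq x hx e a b)
    simpa only [hcovσ, hpζ, conjM_inv, hh, hσ, hζ, map_add, map_sub, map_mul, map_sum, map_one,
      map_div₀, map_pow, map_ofNat, Complex.conj_ofReal] using h1

theorem IsNormalFrame.conj (hc : IsNormalFrame U h c) :
    IsNormalFrame U (conjM h) (conjM c) := by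
  have hcc : ∀ x a b, conjM c x a b = starRingEnd ℂ (c x a b) := fun _ _ _ => rfl
  have key := fun {z : ℂ} (hz : z = 0) => (congrArg (starRingEnd ℂ) hz).trans (map_zero _)
  refine ⟨fun a b => contDiffOn_conj (hc.smooth a b), fun x hx => ?_, ?_, fun x hx a => ?_,
    fun x hx d a => ?_⟩
  · have h1 := congrArg (starRingEnd ℂ).mapMatrix (hc.orthonormal x hx)
    rw [map_mul, map_mul, map_neg, map_one] at h1
    exact h1
  · have h1 := congrArg (starRingEnd ℂ).mapMatrix hc.at_zero
    rw [map_one] at h1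
    exact h1
  · simpa only [christoffel_conj, map_sum, map_mul, Complex.conj_ofReal]
      using key (hc.geodesic x hx a)
  · simpa only [hcc, pd_conj, christoffel_conj, map_sum, map_mul, map_add, Complex.conj_ofReal]
      using key (hc.parallel x hx d a)

/-- Complex conjugation of a tensor field acts on its expansion coefficients by `(-1)^p` times the
operation `plus`. -/
theorem normalCoeff_conj (hc : IsNormalFrame U h c) {n : ℕ} (T : Coord → Tens n) (p : ℕ)
    (A : Fin (n + p) × Fin 2 → Fin 2) :
    normalCoeff (conjM h) (conjM c) (conjT T) p A
      = (-1) ^ (n + p) * plus (normalCoeff h c T p) A := by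
  rw [normalCoeff, normalCoeff, hc.at_zero, hc.conj.at_zero, frameComp_one, frameComp_one,
    iterCovD_conj, plus_toSpinor]
  rfl

theorem symmetrize_smul {p : ℕ} (z : ℂ) (ξ : Spinor p) :
    symmetrize (fun A => z * ξ A) = fun A => z * symmetrize ξ A := by
  funext A
  simp only [symmetrize, ← Finset.mul_sum]
  ring

theorem nullDatum_conj (hc : IsNormalFrame U h c) {q : ℕ} (hr : IsRealSpinor (nullDatum h c σ q)) :
    nullDatum (conjM h) (conjM c) (conjM σ) q = nullDatum h c σ q := by
  have h1 : normalCoeff (conjM h) (conjM c) (matT (conjM σ)) q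
      = fun A => (-1) ^ (2 + q) * plus (normalCoeff h c (matT σ) q) A :=
    funext fun A => normalCoeff_conj hc (matT σ) q A
  rw [nullDatum, h1, symmetrize_smul, symmetrize_plus]
  exact funext fun A => (hr A).symm

end Conj

end StaticNull

theorem mainTheorem4
    (m : ℝ) (hm : m ≠ 0)
    -- abstract null data with `2 + q` index pairs, `q = 0, 1, 2, …`
    (ψ : (q : ℕ) → StaticNull.Spinor (2 + q))
    (hψ_symm : ∀ q, StaticNull.IsTotallySymmetric (ψ q))
    (hψ_real : ∀ q, StaticNull.IsRealSpinor (ψ q))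
    -- a solution in normal coordinates with null data `ψ`
    (U : Set StaticNull.Coord) (hU : IsOpen U) (hU0 : (0 : StaticNull.Coord) ∈ U)
    (h c : StaticNull.MatField) (ζ s : StaticNull.Coord → ℂ) (σ : StaticNull.MatField)
    (hsol : StaticNull.IsConformalStaticVacuum m U h ζ s σ)
    (hc : StaticNull.IsNormalFrame U h c)
    (hdata : ∀ q, StaticNull.nullDatum h c σ q = ψ q) :
    -- the coefficients of the normal expansions satisfy the reality conditions
    (∀ p,
      StaticNull.IsRealSpinor (StaticNull.normalCoeff h c (StaticNull.matT h) p) ∧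
      StaticNull.IsRealSpinor (StaticNull.normalCoeff h c (StaticNull.scalarT ζ) p) ∧
      StaticNull.IsRealSpinor (StaticNull.normalCoeff h c (StaticNull.scalarT s) p) ∧
      StaticNull.IsRealSpinor (StaticNull.normalCoeff h c (StaticNull.matT σ) p)) ∧
    -- so do the Taylor coefficients of metric and frame in the normal coordinates
    (∀ (p : ℕ) (v : Fin p → StaticNull.Coord) (a b : Fin 3),
      (iteratedFDeriv ℝ p (fun x => h x a b) 0 v).im = 0 ∧
      (iteratedFDeriv ℝ p (fun x => c x a b) 0 v).im = 0) ∧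
    -- any other solution with the same null data has the same coefficients
    (∀ (U' : Set StaticNull.Coord) (h' c' : StaticNull.MatField)
      (ζ' s' : StaticNull.Coord → ℂ) (σ' : StaticNull.MatField),
      IsOpen U' → (0 : StaticNull.Coord) ∈ U' →
      StaticNull.IsConformalStaticVacuum m U' h' ζ' s' σ' →
      StaticNull.IsNormalFrame U' h' c' →
      (∀ q, StaticNull.nullDatum h' c' σ' q = ψ q) →
      (∀ p,
        StaticNull.normalCoeff h' c' (StaticNull.matT h') p
          = StaticNull.normalCoeff h c (StaticNull.matT h) p ∧
        StaticNull.normalCoeff h' c' (StaticNull.scalarT ζ') p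
          = StaticNull.normalCoeff h c (StaticNull.scalarT ζ) p ∧
        StaticNull.normalCoeff h' c' (StaticNull.scalarT s') p
          = StaticNull.normalCoeff h c (StaticNull.scalarT s) p ∧
        StaticNull.normalCoeff h' c' (StaticNull.matT σ') p
          = StaticNull.normalCoeff h c (StaticNull.matT σ) p) ∧
      (∀ (p : ℕ) (a b : Fin 3),
        iteratedFDeriv ℝ p (fun x => h' x a b) 0 = iteratedFDeriv ℝ p (fun x => h x a b) 0 ∧
        iteratedFDeriv ℝ p (fun x => c' x a b) 0 = iteratedFDeriv ℝ p (fun x => c x a b) 0)) := by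
  have hconj := StaticNull.expansion_unique hU hU0 hsol hc hU hU0 hsol.conj hc.conj fun q =>
    StaticNull.nullDatum_conj hc (by rw [hdata]; exact hψ_real q)
  obtain ⟨hcoeff, hderiv⟩ := hconj
  have real_of : ∀ {n p : ℕ} {T : StaticNull.Coord → StaticNull.Tens n},
      StaticNull.normalCoeff (StaticNull.conjM h) (StaticNull.conjM c) (StaticNull.conjT T) p
        = StaticNull.normalCoeff h c T p →
      StaticNull.IsRealSpinor (StaticNull.normalCoeff h c T p) := fun hT A => by
    rw [← StaticNull.normalCoeff_conj hc, hT]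
  have im_of : ∀ {f : StaticNull.Coord → ℂ} {p : ℕ} (v : Fin p → StaticNull.Coord),
      iteratedFDeriv ℝ p (fun x => starRingEnd ℂ (f x)) 0 = iteratedFDeriv ℝ p f 0 →
      (iteratedFDeriv ℝ p f 0 v).im = 0 := fun v hf => by
    rw [← Complex.conj_eq_iff_im, ← StaticNull.conj_iteratedFDeriv, hf]
  refine ⟨fun p => ⟨real_of (hcoeff p).1, real_of (hcoeff p).2.1, real_of (hcoeff p).2.2.1,
    real_of (hcoeff p).2.2.2⟩, fun p v a b => ⟨im_of v (hderiv p a b).1,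
    im_of v (hderiv p a b).2⟩, fun U' h' c' ζ' s' σ' hU' hU0' hsol' hc' hdata' => ?_⟩
  exact StaticNull.expansion_unique hU hU0 hsol hc hU' hU0' hsol' hc' fun q => by
    rw [hdata', hdata]
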